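/- Let $d\ge 1$, $s\ge 0$, $r_1,\dots,r_d,p_1,\dots,p_d\in\mathbb N$, and let $\boldsymbol\Delta\subset(0,+\infty)^{d+1}$ be a set of discretization parameters $(\Delta t,\Delta x)$. Let $a_{\ell,\sigma}=a_{\ell,\sigma}(\Delta t,\Delta x)\in\mathbb C$ be given for $\ell\in\mathbb Z^d$ with $-r_k\le \ell_k\le p_k$ ($1\le k\le d$) and $0\le\sigma\le s+1$. Set $(Q_\sigma u)_j=\sum_{\ell}a_{\ell,\sigma}u_{j+\ell}$ and $\widehat{Q_\sigma}(\kappa)=\sum_\ell a_{\ell,\sigma}\kappa_1^{\ell_1}\cdots\kappa_d^{\ell_d}$, and consider the Cauchy problem $$\sum_{\sigma=0}^{s+1}Q_\sigma u^{n+\sigma}=0\quad(n\ge 0),\qquad (u^0,\dots,u^s)=(f^0,\dots,f^s)\in\ell^2(\mathbb Z^d)^{s+1},\qquad(1)$$ with $u^n\in\ell^2(\mathbb Z^d)$ for all $n$. Write $j=(j_1,j')\in\mathbb Z\times\mathbb Z^{d-1}$, and for $\eta=(\eta_2,\dots,\eta_d)\in\mathbb R^{d-1}$, $z\in\mathbb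 C$, $-r_1\le\ell_1\le p_1$ put $$a_{\ell_1,\sigma}^\sharp(\eta)=\sum_{\ell'}a_{(\ell_1,\ell'),\sigma}e^{i\ell'\cdot\eta},\qquad a_{\ell_1}(z,\eta)=\sum_{\sigma=0}^{s+1}z^\sigma a_{\ell_1,\sigma}^\sharp(\eta).$$ Assume that for all $(\Delta t,\Delta x)\in\boldsymbol\Delta$: (Solvability) $Q_{s+1}$ is an isomorphism of $\ell^2(\mathbb Z^d)$, and for all $\eta\in\mathbb R^{d-1}$ $$\frac1{2i\pi}\int_{\mathbb S^1}\frac{\partial_{\kappa_1}\widehat{Q_{s+1}}(\kappa_1,e^{i\eta_2},\dots,e^{i\eta_d})}{\widehat{Q_{s+1}}(\kappa_1,e^{i\eta_2},\dots,e^{i\eta_d})}\,d\kappa_1=0.$$ (Stability) There is a constant $C=C(\Delta t,\Delta x)>0$ such that the solution to (1) satisfies $\sup_n\|u^n\|^2_{\ell^2}\le C\sum_{\sigma=0}^s\|f^\sigma\|^2_{\ell^2}$ for all $f^0,\dots,f^s\in\ell^2(\mathbb Z^d)$. (Noncharacteristic boundary, weak form) $a_{-r_1}(z,\eta)\ne0$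 and $a_{p_1}(z,\eta)\neq 0$ for all $|z|>1$, $\eta\in\mathbb R^{d-1}$. (Technical restriction) Either (i) $Q_{s+1}$ is the identity (explicit scheme), and for all $\eta$ one has $a^\sharp_{-r_1,s}(\eta)\ne0$ if $r_1>0$ and $a^\sharp_{p_1,s}(\eta)\neq 0$ if $p_1>0$; or (ii) $Q_{s+1}$ is not the identity (implicit scheme), and $a^\sharp_{-r_1,s+1}(\eta)\neq 0$ and $a^\sharp_{p_1,s+1}(\eta)\ne0$ for all $\eta$. Let $\mathbb M(z,\eta)$ be the companion matrix of size $p_1+r_1$ of the recurrence $\sum_{\ell_1=-r_1}^{p_1}a_{\ell_1}(z,\eta)w_{j_1+\ell_1}=0$ acting on $(w_{j_1+p_1-1},\dots,w_{j_1-r_1})^T$: its first row is $-\big(a_{p_1-1},\dots,a_{-r_1}\big)(z,\eta)/a_{p_1}(z,\eta)$, it has ones below the diagonal, and zeros elsewhere. Then, for every $(\Delta t,\Delta x)\in\boldsymbol\Delta$, there is a sequence $(\boldsymbol\Pi_n)_{n\in\mathbb N}$ of bounded operators on $\ell^2(\mathbb Z^{d-1};\mathbb C^{p_1+r_1})$ with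 the following properties. (a) Each $\boldsymbol\Pi_n$ is a tangential Fourier multiplier with a continuous matrix-valued symbol $\Pi_n(\eta)$, $\widehat{\boldsymbol\Pi_nv}(\eta)=\Pi_n(\eta)\widehat v(\eta)$ with $\widehat v(\eta)=\sum_{k}e^{-ik\cdot\eta}v_k$. For all $|z|>1$ and $\eta\in\mathbb R^{d-1}$, $\mathbb C^{p_1+r_1}$ is the direct sum of the stable and unstable subspaces of $\mathbb M(z,\eta)$ (the sums of the generalized eigenspaces for the eigenvalues of modulus $<1$, respectively $>1$), and $\sum_{n\ge0}z^{-n}\Pi_n(\eta)$ converges to the projector onto the stable subspace along the unstable subspace. (b) Growth condition: $\sum_{n\in\mathbb N}(1+\delta)^{-n}\|\boldsymbol\Pi_n\|<+\infty$ for all $\delta>0$. (c) Algebraic constraints: $\boldsymbol\Pi_n=\sum_{m=0}^n\boldsymbol\Pi_m\boldsymbol\Pi_{n-m}$ for all $n\in\mathbb N$. (d) For all initial data $f^0,\dots,f^s\in\ell^2(\mathbb Z^d)$ with $f^\sigma_{(j_1,\cdot)}=0$ for all $0\le\sigma\le s$ and $j_1\le p_1$, the solution to (1) satisfies $$\forall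 n\in\mathbb N,\ \forall j_1\le0,\qquad\sum_{m=0}^n\boldsymbol\Pi_{n-m}\begin{pmatrix}u^m_{(j_1+p_1,\cdot)}\\\vdots\\u^m_{(j_1+1-r_1,\cdot)}\end{pmatrix}=0.$$ (e) If the scheme is explicit ($Q_{s+1}$ is the identity), then $\boldsymbol\Pi_0=\begin{pmatrix}0&0\\0&I_{r_1}\end{pmatrix}$. -/

import Mathlib

open scoped Matrix

noncomputable section

/-- Multi-indices of `ℤ^d` with `d = m + 1`; coordinate `0` is the normal direction `j₁`,
the remaining `m = d - 1` coordinates are the tangential ones `j'`. -/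
abbrev Idx (m : ℕ) : Type := Fin (m + 1) → ℤ

/-- `ℓ²(ℤ^d; ℂ)`. -/
abbrev SeqSpace (m : ℕ) : Type := lp (fun _ : Idx m => ℂ) 2

/-- `ℓ²(ℤ^{d-1}; ℂ^N)`, where `ℂ^N` carries the Hermitian norm. -/
abbrev TangSpace (m N : ℕ) : Type := lp (fun _ : Fin m → ℤ => EuclideanSpace ℂ (Fin N)) 2

/-- The box `{ℓ : -r_k ≤ ℓ_k ≤ p_k for all k}`. -/
def stencil {k : ℕ} (r p : Fin k → ℕ) : Finset (Fin k → ℤ) :=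
  Finset.Icc (fun i => -(r i : ℤ)) (fun i => (p i : ℤ))

/-- Coefficients `a_{ℓ,σ}`, `σ = 0, …, s + 1`, of a finite difference scheme
(only the values with `ℓ` in the stencil are ever used). -/
abbrev Coefs (m s : ℕ) : Type := Idx m → Fin (s + 2) → ℂ

section Scheme

variable {m s : ℕ} (r p : Fin (m + 1) → ℕ) (a : Coefs m s)

/-- `(Q_σ u)_j = ∑_{ℓ=-r}^{p} a_{ℓ,σ} u_{j+ℓ}`. -/
def schemeOp (σ : Fin (s + 2)) (u : Idx m → ℂ) (j : Idx m) : ℂ :=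
  ∑ ℓ ∈ stencil r p, a ℓ σ * u (j + ℓ)

/-- The symbol `κ ↦ ∑_{ℓ=-r}^{p} a_{ℓ,σ} κ^ℓ` of `Q_σ`. -/
def schemeSymbol (σ : Fin (s + 2)) (κ : Fin (m + 1) → ℂ) : ℂ :=
  ∑ ℓ ∈ stencil r p, a ℓ σ * ∏ k, κ k ^ ℓ k

/-- `u` is the solution of the Cauchy problem: `∑_{σ=0}^{s+1} Q_σ u^{n+σ} = 0` for `n ≥ 0`, with
`(u^0, …, u^s) = (f^0, …, f^s)`. -/
def IsCauchySolution (f : Fin (s + 1) → SeqSpace m) (u : ℕ → SeqSpace m) : Prop :=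
  (∀ n : ℕ, ∀ j : Idx m, ∑ σ : Fin (s + 2), schemeOp r p a σ (u (n + σ)) j = 0) ∧
    ∀ σ : Fin (s + 1), u σ = f σ

/-- The scheme is explicit: `Q_{s+1}` is the identity. -/
def IsExplicit : Prop :=
  ∀ u : SeqSpace m, schemeOp r p a (Fin.last (s + 1)) u = u

/-- Solvability: `Q_{s+1}` is an isomorphism of `ℓ²(ℤ^d)`, and its symbol satisfies the index
condition in the normal direction. -/
def Solvable : Prop :=
  (∀ g : SeqSpace m, ∃! u : SeqSpace m, schemeOp r p a (Fin.last (s + 1)) u = g) ∧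
    ∀ η : Fin m → ℝ,
      (2 * (Real.pi : ℂ) * Complex.I)⁻¹ *
        (∮ κ₁ in C(0, 1),
          deriv (fun κ : ℂ => schemeSymbol r p a (Fin.last (s + 1))
              (Fin.cons κ fun k => Complex.exp (Complex.I * (η k : ℂ)))) κ₁ /
            schemeSymbol r p a (Fin.last (s + 1))
              (Fin.cons κ₁ fun k => Complex.exp (Complex.I * (η k : ℂ)))) = 0

/-- Stability: a bound on the Cauchy problem that is uniform in time. (The positive weight
`Δx₁ ⋯ Δx_d` of the discrete `ℓ²` norm occurs on both sides and cancels.) -/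
def StableScheme : Prop :=
  ∃ C : ℝ, 0 < C ∧ ∀ (f : Fin (s + 1) → SeqSpace m) (u : ℕ → SeqSpace m),
    IsCauchySolution r p a f u → ∀ n : ℕ, ‖u n‖ ^ 2 ≤ C * ∑ σ, ‖f σ‖ ^ 2

/-- `∑_{ℓ'=-r'}^{p'} a_{(ℓ₁,ℓ'),σ} e^{i ℓ'·η}`. -/
def tangCoef (ℓ₁ : ℤ) (σ : Fin (s + 2)) (η : Fin m → ℝ) : ℂ :=
  ∑ ℓ' ∈ stencil (Fin.tail r) (Fin.tail p),
    a (Fin.cons ℓ₁ ℓ') σ * Complex.exp (Complex.I * ∑ k, (ℓ' k : ℂ) * (η k : ℂ))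

/-- `a_{ℓ₁}(z,η) = ∑_{σ=0}^{s+1} z^σ ∑_{ℓ'} a_{(ℓ₁,ℓ'),σ} e^{i ℓ'·η}`. -/
def normalCoef (ℓ₁ : ℤ) (z : ℂ) (η : Fin m → ℝ) : ℂ :=
  ∑ σ : Fin (s + 2), z ^ (σ : ℕ) * tangCoef r p a ℓ₁ σ η

/-- The discrete boundary is noncharacteristic (weak form): `a_{-r₁}` and `a_{p₁}` do not vanish
for `|z| > 1`. -/
def WeakNonchar : Prop :=
  ∀ (z : ℂ) (η : Fin m → ℝ), 1 < ‖z‖ →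
    normalCoef r p a (-(r 0 : ℤ)) z η ≠ 0 ∧ normalCoef r p a (p 0 : ℤ) z η ≠ 0

/-- The technical restriction on the scheme, in the explicit and in the implicit case. -/
def TechnicalCondition : Prop :=
  (IsExplicit r p a ∧ ∀ η : Fin m → ℝ,
    (0 < r 0 → tangCoef r p a (-(r 0 : ℤ)) (Fin.last s).castSucc η ≠ 0) ∧
    (0 < p 0 → tangCoef r p a (p 0 : ℤ) (Fin.last s).castSucc η ≠ 0)) ∨
  (¬ IsExplicit r p a ∧ ∀ η : Fin m → ℝ,
    tangCoef r p a (-(r 0 : ℤ)) (Fin.last (s + 1)) η ≠ 0 ∧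
    tangCoef r p a (p 0 : ℤ) (Fin.last (s + 1)) η ≠ 0)

/-- The companion matrix `𝕄(z,η)` of the normal recurrence
`∑_{ℓ₁=-r₁}^{p₁} a_{ℓ₁}(z,η) w_{j₁+ℓ₁} = 0`, acting on `(w_{j₁+p₁-1}, …, w_{j₁-r₁})`. -/
def companion (z : ℂ) (η : Fin m → ℝ) : Matrix (Fin (p 0 + r 0)) (Fin (p 0 + r 0)) ℂ :=
  Matrix.of fun i j =>
    if (i : ℕ) = 0 then
      -(normalCoef r p a ((p 0 : ℤ) - 1 - (j : ℕ)) z η / normalCoef r p a (p 0 : ℤ) z η)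
    else if (i : ℕ) = (j : ℕ) + 1 then 1 else 0

end Scheme

/-- Sum of the generalized eigenspaces of `A` for eigenvalues in the open unit disk. -/
def stableSpace {N : ℕ} (A : Matrix (Fin N) (Fin N) ℂ) : Submodule ℂ (Fin N → ℂ) :=
  ⨆ μ : {μ : ℂ // ‖μ‖ < 1}, Module.End.maxGenEigenspace (Matrix.toLin' A) μ

/-- Sum of the generalized eigenspaces of `A` for eigenvalues outside the closed unit disk. -/
def unstableSpace {N : ℕ} (A : Matrix (Fin N) (Fin N) ℂ) : Submodule ℂ (Fin N → ℂ) :=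
  ⨆ μ : {μ : ℂ // 1 < ‖μ‖}, Module.End.maxGenEigenspace (Matrix.toLin' A) μ

/-- `ℂ^N` is the direct sum of the stable and the unstable subspace of `A`, and `P` is the
projector on the former along the latter. -/
def IsStableProjector {N : ℕ} (A P : Matrix (Fin N) (Fin N) ℂ) : Prop :=
  IsCompl (stableSpace A) (unstableSpace A) ∧
    (∀ x ∈ stableSpace A, P *ᵥ x = x) ∧ ∀ x ∈ unstableSpace A, P *ᵥ x = 0

/-- The Fourier series `η ↦ ∑_k e^{-i k·η} v_k` (a finite sum for finitely supported `v`). -/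
def tangFourier {m N : ℕ} (v : TangSpace m N) (η : Fin m → ℝ) : Fin N → ℂ :=
  fun i => ∑' k : Fin m → ℤ, Complex.exp (-(Complex.I * ∑ l, (k l : ℂ) * (η l : ℂ))) * v k i

/-- The bounded operator `T` is the Fourier multiplier with (matrix valued, periodic) symbol `S`:
the Fourier transform of `T v` is `S(η) v̂(η)`, i.e. `(T v)_j` is the `j`-th Fourier coefficient of
`S v̂`. As finitely supported sequences are dense, this determines `T`. -/
def IsFourierMultiplier {m N : ℕ} (S : (Fin m → ℝ) → Matrix (Fin N) (Fin N) ℂ)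
    (T : TangSpace m N →L[ℂ] TangSpace m N) : Prop :=
  ∀ v : TangSpace m N, (Function.support (v : (Fin m → ℤ) → EuclideanSpace ℂ (Fin N))).Finite →
    ∀ (j : Fin m → ℤ) (i : Fin N),
      T v j i = ((2 * (Real.pi : ℂ)) ^ m)⁻¹ *
        ∫ η in Set.Icc (fun _ : Fin m => -Real.pi) (fun _ => Real.pi),
          Complex.exp (Complex.I * ∑ l, (j l : ℂ) * (η l : ℂ)) * (S η *ᵥ tangFourier v η) i

theorem memlp_window {m : ℕ} (N : ℕ) (u : SeqSpace m) (j₁ : ℤ) :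
    Memℓp (fun j' : Fin m → ℤ => (WithLp.toLp 2 fun i : Fin N =>
      u (Fin.cons (j₁ - (i : ℕ)) j') : EuclideanSpace ℂ (Fin N))) 2 := by
  have hu : Summable fun j : Idx m => ‖u j‖ ^ 2 := by
    have h := (memℓp_gen_iff (p := 2) (by norm_num)).1 (lp.memℓp u)
    simpa using h
  refine (memℓp_gen_iff (by norm_num)).2 ?_
  have key : Summable fun j' : Fin m → ℤ =>
      ∑ i : Fin N, ‖u (Fin.cons (j₁ - (i : ℕ)) j')‖ ^ 2 := by
    refine summable_sum fun i _ => ?_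
    exact hu.comp_injective
      (i := fun j' : Fin m → ℤ => (Fin.cons (j₁ - (i : ℕ)) j' : Idx m))
      (Fin.cons_right_injective (α := fun _ => ℤ) _)
  simpa [EuclideanSpace.norm_sq_eq] using key

/-- The tangential sequence of vectors `(u_{(j₁,·)}, u_{(j₁-1,·)}, …, u_{(j₁-N+1,·)})^T`. -/
def window {m : ℕ} (N : ℕ) (u : SeqSpace m) (j₁ : ℤ) : TangSpace m N :=
  ⟨fun j' => WithLp.toLp 2 fun i : Fin N => u (Fin.cons (j₁ - (i : ℕ)) j'), memlp_window N u j₁⟩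

end

/-! Write `L(z) = ∑ z^σ Q_σ`. Let `ι` extend a window by zero from the rows `-r₁ ≤ j₁ < p₁`, let `ω`
restrict to these rows, and let `χ` cut off to `j₁ < 0`. The operators `Π_n` are the coefficients in
powers of `1/z` of the discrete Calderón projector `ω L(z)⁻¹ χ L(z) ι`. The expansion needs only the
inverse of `Q_{s+1}` and is computed by forward substitution (`Solvable.response`); uniqueness is
the triangularity of the convolution equation (`eq_zero_of_conv_eq_zero`).

An equation at row `j₁` reads the rows from `j₁ - r₁` to `j₁ + p₁`, so truncating a sequence at `j₁
= 0` disturbs `L` only through the boundary rows. If `L x` is supported in `j₁ < 0`, the truncation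
of `x` to the right, completed by its boundary rows, is the response to `ω x`; hence `Π` fixes `ω
x`. If `L x` vanishes in `j₁ < 0`, the negative of the part of `x` in `j₁ < -r₁` is that response
and has zero window; hence `Π` annihilates `ω x` (`Solvable.conv_proj_of_right`,
`Solvable.conv_proj_of_left`). Applied to responses, the first fact is `Π² = Π`, the algebraic
constraints. Applied to translated solutions, the second gives the relations for the Cauchy problem.
From index one on, a response solves the homogeneous scheme, so stability bounds `Π_n` uniformly in
`n`.

For the spectral statement, stability gives the von Neumann condition: for `|z| > 1` the symbol of
`L(z)` has no zero on the torus (`Solvable.convSymbol_resolventCoef_ne_zero`). The series of symbols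
of `Π_n` then sums to an integral over the normal frequency, which is the same projector built for
the scalar recurrence with coefficients `a_ℓ(z,η)`. Stable vectors of the companion matrix are
windows of solutions summable to the right, unstable ones are windows of solutions summable to the
left, and the truncation argument shows that the integral fixes the former and annihilates the
latter. The von Neumann condition excludes eigenvalues on the unit circle, so the two subspaces span
(`isStableProjector_scalarProj`). -/

noncomputable section

open Filter Topology Finset MeasureTheory

/-! ### Bounded operators between `ℓ²` spaces given by their coordinates -/

section Coordinates

variable {α β : Type*} {E : α → Type*} {F : β → Type*}
  [∀ i, NormedAddCommGroup (E i)] [∀ i, NormedSpace ℂ (E i)] [∀ i, CompleteSpace (E i)]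
  [∀ i, NormedAddCommGroup (F i)] [∀ i, NormedSpace ℂ (F i)] [∀ i, CompleteSpace (F i)]

/-- A family of bounded functionals which maps `ℓ²` to `ℓ²` defines a bounded operator, by the
closed graph theorem. -/
def lpOfCoord (c : ∀ j, lp E 2 →L[ℂ] F j) (h : ∀ f, Memℓp (fun j => c j f) 2) :
    lp E 2 →L[ℂ] lp F 2 :=
  ContinuousLinearMap.ofSeqClosedGraph
    (g := { toFun := fun f => ⟨fun j => c j f, h f⟩
            map_add' := fun f g => by ext j; exact map_add (c j) f g
            map_smul' := fun k f => by ext j; exact map_smul (c j) k f })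
    (by
      intro u x y hu hy
      ext j
      have h1 : Tendsto (fun n => c j (u n)) atTop (𝓝 (c j x)) :=
        ((c j).continuous.tendsto x).comp hu
      have h2 := ((lp.evalCLM ℂ F 2 j).continuous.tendsto y).comp hy
      exact tendsto_nhds_unique h2 h1)

@[simp] theorem lpOfCoord_apply (c : ∀ j, lp E 2 →L[ℂ] F j) (h : ∀ f, Memℓp (fun j => c j f) 2)
    (f : lp E 2) (j : β) : lpOfCoord c h f j = c j f := rfl

end Coordinates

theorem memlp_two_iff {α : Type*} {E : Type*} [NormedAddCommGroup E] {f : α → E} :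
    Memℓp f 2 ↔ Summable fun i => ‖f i‖ ^ 2 := by
  simpa using memℓp_gen_iff (E := fun _ : α => E) (f := f) (p := 2) (by norm_num)

theorem memlp_two_sum {α ι : Type*} {E : Type*} [NormedAddCommGroup E]
    (s : Finset ι) {f : ι → α → E} (h : ∀ i ∈ s, Memℓp (f i) 2) :
    Memℓp (fun x => ∑ i ∈ s, f i x) 2 := by
  classical
  induction s using Finset.induction_on with
  | empty => exact (zero_memℓp : Memℓp (0 : α → E) 2)
  | insert i s hi ih =>
    simp only [Finset.sum_insert hi]
    exact (h i (by simp)).add (ih fun k hk => h k (by simp [hk]))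

theorem memlp_two_comp {α β : Type*} {E : Type*} [NormedAddCommGroup E] {f : β → E}
    (hf : Memℓp f 2) {g : α → β} (hg : Function.Injective g) : Memℓp (fun x => f (g x)) 2 :=
  memlp_two_iff.2 ((memlp_two_iff.1 hf).comp_injective hg)

/-! ### Convolution of sequences of operators -/

theorem sum_antidiagonal_assoc {M : Type*} [AddCommMonoid M] (n : ℕ) (f : ℕ → ℕ → ℕ → M) :
    ∑ x ∈ antidiagonal n, ∑ y ∈ antidiagonal x.1, f y.1 y.2 x.2 =
      ∑ x ∈ antidiagonal n, ∑ y ∈ antidiagonal x.2, f x.1 y.1 y.2 := by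
  rw [Finset.sum_sigma', Finset.sum_sigma']
  refine Finset.sum_nbij' (fun ⟨⟨_i, j⟩, ⟨k, l⟩⟩ => ⟨(k, l + j), (l, j)⟩)
    (fun ⟨⟨i, _j⟩, ⟨k, l⟩⟩ => ⟨(i + k, l), (i, k)⟩) ?_ ?_ ?_ ?_ ?_ <;>
    aesop (add simp [add_assoc])

/-- Triangularity: `A 0` meets only `y n`, and every other term contains an earlier `y k`, zero by
induction. It serves both for the uniqueness of responses and for their Fourier representation. -/
theorem eq_zero_of_conv_eq_zero {R V : Type*} [Semiring R] [AddCommGroup V] [Module R V]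
    {A : ℕ → V →ₗ[R] V} (hA : Function.Injective (A 0)) {y : ℕ → V}
    (h : ∀ n, ∑ x ∈ antidiagonal n, A x.1 (y x.2) = 0) (n : ℕ) : y n = 0 := by
  induction n using Nat.strong_induction_on with
  | _ n ih =>
    have h1 := h n
    rw [Finset.sum_eq_single (0, n)] at h1
    · exact hA (by simpa using h1)
    · rintro ⟨i, k⟩ hik hne
      have hik' : i + k = n := by simpa using hik
      have : k < n := by
        rcases Nat.eq_zero_or_pos i with rfl | hi
        · exact absurd (by simpa using hik') (by simpa using hne)
        · omega
      simp [ih k this]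
    · simp

/-! ### The operators of the scheme on `ℓ²` -/

section Operators

variable {m : ℕ} (r p : Fin (m + 1) → ℕ) (c : Idx m → ℂ)

/-- The finite difference operator `(C u)_j = ∑_{ℓ=-r}^{p} c_ℓ u_{j+ℓ}` on `ℓ²(ℤ^d)`. -/
def convCLM : SeqSpace m →L[ℂ] SeqSpace m :=
  lpOfCoord (fun j => ∑ ℓ ∈ stencil r p, c ℓ • lp.evalCLM ℂ (fun _ : Idx m => ℂ) 2 (j + ℓ))
    (fun f => by
      have h : Memℓp (fun j : Idx m => ∑ ℓ ∈ stencil r p, c ℓ * f (j + ℓ)) 2 :=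
        memlp_two_sum _ fun ℓ _ => (memlp_two_comp (lp.memℓp f) (add_left_injective ℓ)).const_mul _
      convert h using 2 with j
      simp [lp.evalCLM])

@[simp] theorem convCLM_apply (u : SeqSpace m) (j : Idx m) :
    convCLM r p c u j = ∑ ℓ ∈ stencil r p, c ℓ * u (j + ℓ) := by
  simp [convCLM, lp.evalCLM]

theorem schemeOp_eq_convCLM {s : ℕ} (a : Coefs m s) (σ : Fin (s + 2)) (u : SeqSpace m) :
    schemeOp r p a σ u = convCLM r p (fun ℓ => a ℓ σ) u := by
  ext j
  simp [schemeOp]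

/-- Restriction to the half space `j₁ < 0`. -/
def cutNeg (m : ℕ) : SeqSpace m →L[ℂ] SeqSpace m :=
  lpOfCoord (fun j => if j 0 < 0 then lp.evalCLM ℂ (fun _ : Idx m => ℂ) 2 j else 0)
    (fun f => by
      refine memlp_two_iff.2 (.of_nonneg_of_le (fun _ => by positivity) (fun j => ?_)
        (memlp_two_iff.1 (lp.memℓp f)))
      by_cases hj : j 0 < 0 <;> simp [hj, lp.evalCLM])

@[simp] theorem cutNeg_apply (u : SeqSpace m) (j : Idx m) :
    cutNeg m u j = if j 0 < 0 then u j else 0 := by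
  by_cases hj : j 0 < 0 <;> simp [cutNeg, hj, lp.evalCLM]

/-- Translation in `ℤ^d`. -/
def translateCLM (ℓ : Idx m) : SeqSpace m →L[ℂ] SeqSpace m :=
  lpOfCoord (fun j => lp.evalCLM ℂ (fun _ : Idx m => ℂ) 2 (j + ℓ))
    (fun f => memlp_two_comp (lp.memℓp f) (add_left_injective ℓ))

@[simp] theorem translateCLM_apply (ℓ : Idx m) (u : SeqSpace m) (j : Idx m) :
    translateCLM ℓ u j = u (j + ℓ) := rfl

/-- `window N · j₁` as a bounded operator. -/
def windowCLM (m N : ℕ) (j₁ : ℤ) : SeqSpace m →L[ℂ] TangSpace m N :=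
  lpOfCoord (fun j' => (EuclideanSpace.equiv (Fin N) ℂ).symm.toContinuousLinearMap ∘L
      ContinuousLinearMap.pi fun i : Fin N =>
        lp.evalCLM ℂ (fun _ : Idx m => ℂ) 2 (Fin.cons (j₁ - (i : ℕ)) j'))
    (fun f => memlp_window N f j₁)

theorem windowCLM_eq (N : ℕ) (j₁ : ℤ) (u : SeqSpace m) : windowCLM m N j₁ u = window N u j₁ := rfl

@[simp] theorem windowCLM_apply (N : ℕ) (j₁ : ℤ) (u : SeqSpace m) (j' : Fin m → ℤ) (i : Fin N) :
    windowCLM m N j₁ u j' i = u (Fin.cons (j₁ - (i : ℕ)) j') := rfl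

/-- The adjoint of `windowCLM`: the rows `j₁, j₁ - 1, …, j₁ - N + 1` are prescribed, all other
rows vanish. -/
def embedCLM (m N : ℕ) (j₁ : ℤ) : TangSpace m N →L[ℂ] SeqSpace m :=
  lpOfCoord (fun j => ∑ i : Fin N, if j 0 = j₁ - (i : ℕ) then
      (EuclideanSpace.proj i : EuclideanSpace ℂ (Fin N) →L[ℂ] ℂ) ∘L
        lp.evalCLM ℂ (fun _ : Fin m → ℤ => EuclideanSpace ℂ (Fin N)) 2 (Fin.tail j) else 0)
    (fun f => by
      have h : Memℓp (fun j : Idx m => ∑ i : Fin N,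
          if j 0 = j₁ - (i : ℕ) then f (Fin.tail j) i else 0) 2 := by
        refine memlp_two_sum _ fun i _ => memlp_two_iff.2 ?_
        have hinj := Fin.cons_right_injective (α := fun _ : Fin (m + 1) => ℤ) (j₁ - (i : ℕ))
        refine (hinj.summable_iff ?_).1 ?_
        · intro j hj
          have : ¬ j 0 = j₁ - (i : ℕ) := fun h0 => hj ⟨Fin.tail j, by rw [← h0, Fin.cons_self_tail]⟩
          simp [this]
        · refine .of_nonneg_of_le (fun _ => sq_nonneg _) (fun j' => ?_)
            (memlp_two_iff.1 (lp.memℓp f))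
          simp only [Function.comp, Fin.cons_zero, if_true, Fin.tail_cons]
          exact pow_le_pow_left₀ (norm_nonneg _) (PiLp.norm_apply_le (f j') i) 2
      convert h using 2 with j
      simp only [_root_.sum_apply]
      refine Finset.sum_congr rfl fun i _ => ?_
      by_cases h0 : j 0 = j₁ - (i : ℕ) <;> simp [h0, lp.evalCLM])

theorem embedCLM_apply (N : ℕ) (j₁ : ℤ) (v : TangSpace m N) (j : Idx m) :
    embedCLM m N j₁ v j = ∑ i : Fin N, if j 0 = j₁ - (i : ℕ) then v (Fin.tail j) i else 0 := by
  simp only [embedCLM, lpOfCoord_apply, _root_.sum_apply]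
  refine Finset.sum_congr rfl fun i _ => ?_
  by_cases h0 : j 0 = j₁ - (i : ℕ) <;> simp [h0, lp.evalCLM]

theorem embedCLM_windowCLM_apply (N : ℕ) (j₁ : ℤ) (u : SeqSpace m) (j : Idx m) :
    embedCLM m N j₁ (windowCLM m N j₁ u) j = if j₁ - N < j 0 ∧ j 0 ≤ j₁ then u j else 0 := by
  rw [embedCLM_apply]
  split_ifs with h
  · rw [Finset.sum_eq_single ⟨(j₁ - j 0).toNat, by omega⟩]
    · have h0 : j 0 = j₁ - ((j₁ - j 0).toNat : ℕ) := by omega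
      rw [if_pos h0, windowCLM_apply]
      simp only
      rw [← h0, Fin.cons_self_tail]
    · intro i _ hi
      rw [if_neg]
      intro h0
      exact hi (Fin.ext (by simp; omega))
    · simp
  · refine Finset.sum_eq_zero fun i _ => ?_
    rw [if_neg]
    have := i.2
    omega

theorem windowCLM_embedCLM (N : ℕ) (j₁ : ℤ) (v : TangSpace m N) :
    windowCLM m N j₁ (embedCLM m N j₁ v) = v := by
  ext j' i
  rw [windowCLM_apply, embedCLM_apply, Finset.sum_eq_single i]
  · simp
  · intro k _ hk
    rw [if_neg]
    simp only [Fin.cons_zero]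
    intro h
    exact hk (Fin.ext (by omega))
  · simp

end Operators

/-! ### Truncation to half spaces and the boundary rows -/

section Locality

variable {m : ℕ} {r p : Fin (m + 1) → ℕ}

theorem mem_stencil_zero {ℓ : Idx m} (h : ℓ ∈ stencil r p) :
    -(r 0 : ℤ) ≤ ℓ 0 ∧ ℓ 0 ≤ (p 0 : ℤ) := by
  rw [stencil, Finset.mem_Icc] at h
  exact ⟨h.1 0, h.2 0⟩

/-- The window operator onto the rows `-r₁, …, p₁ - 1`. -/
abbrev bdryWindow (r p : Fin (m + 1) → ℕ) : SeqSpace m →L[ℂ] TangSpace m (p 0 + r 0) :=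
  windowCLM m (p 0 + r 0) ((p 0 : ℤ) - 1)

/-- The extension by zero from the rows `-r₁, …, p₁ - 1`. -/
abbrev bdryEmbed (r p : Fin (m + 1) → ℕ) : TangSpace m (p 0 + r 0) →L[ℂ] SeqSpace m :=
  embedCLM m (p 0 + r 0) ((p 0 : ℤ) - 1)

theorem bdryEmbed_bdryWindow_apply (x : SeqSpace m) (j : Idx m) :
    bdryEmbed r p (bdryWindow r p x) j =
      if -(r 0 : ℤ) ≤ j 0 ∧ j 0 < (p 0 : ℤ) then x j else 0 := by
  rw [embedCLM_windowCLM_apply]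
  congr 1
  push_cast
  exact propext ⟨fun h => by omega, fun h => by omega⟩

/-- If the equation `C x = 0` holds in the half space `j₁ ≥ 0`, the truncation of `x` to this half
space, corrected on the boundary rows, solves a boundary problem with data read off `x`. -/
theorem convCLM_truncate_right (c : Idx m → ℂ) (x : SeqSpace m) :
    convCLM r p c (x - cutNeg m x + cutNeg m (bdryEmbed r p (bdryWindow r p x))) =
      cutNeg m (convCLM r p c (bdryEmbed r p (bdryWindow r p x))) +
        (convCLM r p c x - cutNeg m (convCLM r p c x)) := by
  ext j
  simp only [lp.coeFn_add, lp.coeFn_sub, Pi.add_apply, Pi.sub_apply, convCLM_apply, cutNeg_apply,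
    bdryEmbed_bdryWindow_apply]
  -- An equation at `j₁ < 0` reads rows below `p₁`, where the truncated sequence equals `ι ω x`; one
  -- at `j₁ ≥ 0` reads rows from `-r₁` on, where it equals `x`.
  by_cases hj : j 0 < 0
  · simp only [hj, if_true, sub_self, add_zero]
    refine Finset.sum_congr rfl fun ℓ hℓ => ?_
    have := mem_stencil_zero hℓ
    congr 1
    split_ifs <;> first | omega | simp
  · simp only [hj, if_false, sub_zero, zero_add]
    refine Finset.sum_congr rfl fun ℓ hℓ => ?_
    have := mem_stencil_zero hℓ
    congr 1
    split_ifs <;> first | omega | simp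

/-- The truncated sequence is `-x` on the rows `j₁ < -r₁` and zero elsewhere. Equations at `j₁ ≥ 0`
do not see it. On the rows below `p₁`, which are all that equations at `j₁ < 0` read, it equals `ι ω
x - x`. -/
theorem convCLM_truncate_left (c : Idx m → ℂ) (x : SeqSpace m) :
    convCLM r p c (cutNeg m (bdryEmbed r p (bdryWindow r p x)) - cutNeg m x) =
      cutNeg m (convCLM r p c (bdryEmbed r p (bdryWindow r p x))) -
        cutNeg m (convCLM r p c x) := by
  ext j
  simp only [lp.coeFn_sub, Pi.sub_apply, convCLM_apply, cutNeg_apply,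
    bdryEmbed_bdryWindow_apply]
  by_cases hj : j 0 < 0
  · simp only [hj, if_true, ← Finset.sum_sub_distrib]
    refine Finset.sum_congr rfl fun ℓ hℓ => ?_
    have := mem_stencil_zero hℓ
    rw [← mul_sub]
    congr 1
    simp only [Pi.add_apply]
    split_ifs <;> first | omega | simp
  · simp only [hj, if_false, sub_zero]
    refine Finset.sum_eq_zero fun ℓ hℓ => ?_
    have := mem_stencil_zero hℓ
    simp only [Pi.add_apply]
    split_ifs <;> first | omega | simp

theorem bdryWindow_truncate_right (x : SeqSpace m) :
    bdryWindow r p (x - cutNeg m x + cutNeg m (bdryEmbed r p (bdryWindow r p x))) =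
      bdryWindow r p x := by
  ext j' i
  have := i.2
  simp only [windowCLM_apply, lp.coeFn_add, lp.coeFn_sub, Pi.add_apply, Pi.sub_apply, cutNeg_apply,
    bdryEmbed_bdryWindow_apply, Fin.cons_zero]
  split_ifs <;> first | omega | simp

theorem bdryWindow_truncate_left (x : SeqSpace m) :
    bdryWindow r p (cutNeg m (bdryEmbed r p (bdryWindow r p x)) - cutNeg m x) = 0 := by
  ext j' i
  have := i.2
  simp only [windowCLM_apply, lp.coeFn_sub, Pi.sub_apply, cutNeg_apply,
    bdryEmbed_bdryWindow_apply, Fin.cons_zero]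
  split_ifs <;> first | omega | simp

end Locality

/-! ### The response to boundary data and the operators `Π_n` -/

section Response

variable {m s : ℕ} (r p : Fin (m + 1) → ℕ) (a : Coefs m s)

/-- The coefficients in decreasing order of the time index, extended by zero. -/
def revCoef (i : ℕ) (ℓ : Idx m) : ℂ :=
  if h : i ≤ s + 1 then a ℓ ⟨s + 1 - i, by omega⟩ else 0

theorem revCoef_sub (σ : Fin (s + 2)) (ℓ : Idx m) : revCoef a (s + 1 - σ) ℓ = a ℓ σ := by
  have h1 := σ.2
  rw [revCoef, dif_pos (by omega)]
  congr
  omega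

theorem revCoef_eq_zero {i : ℕ} (hi : s + 1 < i) : revCoef a i = 0 := by
  ext ℓ
  rw [revCoef, dif_neg (by omega), Pi.zero_apply]

/-- The operators `Q_{s+1-i}`, extended by zero. -/
def revOp (i : ℕ) : SeqSpace m →L[ℂ] SeqSpace m := convCLM r p (revCoef a i)

theorem revOp_eq_zero {i : ℕ} (hi : s + 1 < i) : revOp r p a i = 0 := by
  ext u j
  simp [revOp, revCoef_eq_zero a hi]

theorem revOp_zero_apply (u : SeqSpace m) :
    ⇑(revOp r p a 0 u) = schemeOp r p a (Fin.last (s + 1)) u := by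
  rw [schemeOp_eq_convCLM, revOp]
  congr 2

/-- Summation over an antidiagonal against a sequence that vanishes beyond `s + 1`. -/
theorem sum_antidiagonal_eq_sum_fin {M : Type*} [AddCommMonoid M] (n : ℕ) (f : ℕ → ℕ → M)
    (hf : ∀ i k, s + 1 < i → f i k = 0) :
    ∑ x ∈ antidiagonal (n + s + 1), f x.1 x.2 = ∑ σ : Fin (s + 2), f (s + 1 - σ) (n + σ) := by
  rw [Finset.Nat.sum_antidiagonal_eq_sum_range_succ f]
  have h1 : range (s + 2) ⊆ range (n + s + 1 + 1) := by
    intro i hi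
    simp only [Finset.mem_range] at *
    omega
  rw [← Finset.sum_subset h1, ← Fin.sum_univ_eq_sum_range (fun i => f i (n + s + 1 - i)),
    ← Equiv.sum_comp Fin.revPerm]
  · refine Finset.sum_congr rfl fun σ _ => ?_
    have := σ.2
    have h2 : ((Fin.revPerm σ : Fin (s + 2)) : ℕ) = s + 1 - σ := by
      rw [Fin.revPerm_apply, Fin.val_rev]; omega
    rw [h2]
    congr 1
    omega
  · intro i _ hi
    simp only [Finset.mem_range] at hi
    exact hf _ _ (by omega)

/-- The scheme at time `n` is the convolution at index `n + s + 1`. Convolutions at indices up to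
`s` are not equations of the scheme; they involve initial data only. -/
theorem conv_revOp_eq_schemeOp (u : ℕ → SeqSpace m) (n : ℕ) (j : Idx m) :
    (∑ x ∈ antidiagonal (n + s + 1), revOp r p a x.1 (u x.2)) j =
      ∑ σ : Fin (s + 2), schemeOp r p a σ (u (n + σ)) j := by
  rw [sum_antidiagonal_eq_sum_fin (s := s) n (fun i k => revOp r p a i (u k))
    (fun i k hi => by simp [revOp_eq_zero r p a hi]), lp.coeFn_sum, Finset.sum_apply]
  refine Finset.sum_congr rfl fun σ _ => ?_
  rw [schemeOp_eq_convCLM, revOp, show revCoef a (s + 1 - σ) = fun ℓ => a ℓ σ from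
    funext fun ℓ => revCoef_sub a σ ℓ]

variable {r p a}

theorem Solvable.bijective (h : Solvable r p a) : Function.Bijective (revOp r p a 0) := by
  rw [Function.bijective_iff_existsUnique]
  intro g
  obtain ⟨u, hu, huniq⟩ := h.1 g
  refine ⟨u, lp.ext ((revOp_zero_apply r p a u).trans hu), fun v hv => huniq v ?_⟩
  exact (revOp_zero_apply r p a v).symm.trans (congrArg _ hv)

/-- `Q_{s+1}` as an invertible operator. -/
def Solvable.equiv (h : Solvable r p a) : SeqSpace m ≃L[ℂ] SeqSpace m :=
  ContinuousLinearEquiv.ofBijective (revOp r p a 0) (LinearMap.ker_eq_bot.2 h.bijective.1)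
    (LinearMap.range_eq_top.2 h.bijective.2)

/-- Forward substitution in a lower triangular convolution equation. -/
def forwardSubst {V : Type*} [AddCommGroup V] (A : ℕ → V → V) (B : V → V) (b : ℕ → V) : ℕ → V
  | n => B (b n - ∑ k : Fin n, A (n - k) (forwardSubst A B b k))
termination_by n => n
decreasing_by exact k.2

theorem sum_antidiagonal_eq_add {M : Type*} [AddCommMonoid M] (n : ℕ) (f : ℕ → ℕ → M) :
    ∑ x ∈ antidiagonal n, f x.1 x.2 = f 0 n + ∑ k ∈ range n, f (n - k) k := by
  rw [← Finset.Nat.sum_antidiagonal_swap]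
  simp only [Prod.fst_swap, Prod.snd_swap]
  rw [Finset.Nat.sum_antidiagonal_eq_sum_range_succ (fun k i => f i k), Finset.sum_range_succ,
    add_comm]
  simp

theorem forwardSubst_spec {V : Type*} [AddCommGroup V] {A : ℕ → V → V} {B : V → V}
    (hB : ∀ v, A 0 (B v) = v) (b : ℕ → V) (n : ℕ) :
    ∑ x ∈ antidiagonal n, A x.1 (forwardSubst A B b x.2) = b n := by
  rw [sum_antidiagonal_eq_add n fun i k => A i (forwardSubst A B b k),
    forwardSubst.eq_1 A B b n, hB, Finset.sum_range fun k => A (n - k) (forwardSubst A B b k)]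
  abel

/-- The response `X_n` of the scheme to boundary data: the coefficients of `L⁻¹ 1_{j₁<0} L ι` in
powers of `1 / z`, where `L = ∑ z^σ Q_σ` and `ι` is the extension by zero. -/
def Solvable.response (h : Solvable r p a) : ℕ → (TangSpace m (p 0 + r 0) →L[ℂ] SeqSpace m) :=
  forwardSubst (fun i X => (revOp r p a i).comp X) (fun X => h.equiv.symm.toContinuousLinearMap.comp X)
    (fun n => (cutNeg m).comp ((revOp r p a n).comp (bdryEmbed r p)))

/-- This is `L X = χ L ι`, coefficient by coefficient. -/
theorem Solvable.response_spec (h : Solvable r p a) (n : ℕ) (v : TangSpace m (p 0 + r 0)) :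
    ∑ x ∈ antidiagonal n, revOp r p a x.1 (h.response x.2 v) =
      cutNeg m (revOp r p a n (bdryEmbed r p v)) := by
  have h1 := forwardSubst_spec (A := fun i X => (revOp r p a i).comp X)
    (B := fun X => h.equiv.symm.toContinuousLinearMap.comp X)
    (fun X => by
      ext1 v
      exact h.equiv.apply_symm_apply (X v))
    (fun n => (cutNeg m).comp ((revOp r p a n).comp (bdryEmbed r p))) n
  have h2 := congrArg (fun T : TangSpace m (p 0 + r 0) →L[ℂ] SeqSpace m => T v) h1
  simpa [_root_.sum_apply, Solvable.response] using h2

/-- Uniqueness for the boundary problem. -/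
theorem Solvable.eq_conv_response (h : Solvable r p a) {w : ℕ → TangSpace m (p 0 + r 0)}
    {y : ℕ → SeqSpace m}
    (hy : ∀ n, ∑ x ∈ antidiagonal n, revOp r p a x.1 (y x.2) =
      ∑ x ∈ antidiagonal n, cutNeg m (revOp r p a x.1 (bdryEmbed r p (w x.2)))) (n : ℕ) :
    y n = ∑ x ∈ antidiagonal n, h.response x.1 (w x.2) := by
  rw [← sub_eq_zero]
  refine eq_zero_of_conv_eq_zero (A := fun i => (revOp r p a i).toLinearMap)
    (y := fun n => y n - ∑ x ∈ antidiagonal n, h.response x.1 (w x.2)) h.bijective.1 (fun n => ?_) n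
  simp only [ContinuousLinearMap.coe_coe, map_sub, Finset.sum_sub_distrib, hy, map_sum]
  rw [← sum_antidiagonal_assoc n fun i k l => revOp r p a i (h.response k (w l)), sub_eq_zero]
  exact Finset.sum_congr rfl fun x _ => (h.response_spec x.1 (w x.2)).symm

/-- The operators `Π_n`. -/
def Solvable.proj (h : Solvable r p a) (n : ℕ) :
    TangSpace m (p 0 + r 0) →L[ℂ] TangSpace m (p 0 + r 0) :=
  (bdryWindow r p).comp (h.response n)

/-- The hypothesis places `L x` in `j₁ < 0`. The right truncation of `x` then solves the equation of
the response to `ω x`, so it is this response; its window is still `ω x`. -/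
theorem Solvable.conv_proj_of_right (h : Solvable r p a) {x : ℕ → SeqSpace m}
    (hx : ∀ n, cutNeg m (∑ k ∈ antidiagonal n, revOp r p a k.1 (x k.2)) =
      ∑ k ∈ antidiagonal n, revOp r p a k.1 (x k.2)) (n : ℕ) :
    ∑ k ∈ antidiagonal n, h.proj k.1 (bdryWindow r p (x k.2)) = bdryWindow r p (x n) := by
  have h1 := h.eq_conv_response (w := fun n => bdryWindow r p (x n)) (y := fun n =>
    x n - cutNeg m (x n) + cutNeg m (bdryEmbed r p (bdryWindow r p (x n)))) (fun n => by
      simp only [revOp, convCLM_truncate_right, Finset.sum_add_distrib, Finset.sum_sub_distrib]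
      have := hx n
      simp only [map_sum, revOp] at this
      rw [this, sub_self, add_zero]) n
  have h2 := congrArg (bdryWindow r p) h1
  simp only [bdryWindow_truncate_right, map_sum] at h2
  exact h2.symm

/-- Here `L x` vanishes in `j₁ < 0`, and the left truncation solves the same response equation. By
uniqueness it is the response to `ω x`, and it is zero on the boundary rows. -/
theorem Solvable.conv_proj_of_left (h : Solvable r p a) {x : ℕ → SeqSpace m}
    (hx : ∀ n, cutNeg m (∑ k ∈ antidiagonal n, revOp r p a k.1 (x k.2)) = 0) (n : ℕ) :
    ∑ k ∈ antidiagonal n, h.proj k.1 (bdryWindow r p (x k.2)) = 0 := by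
  have h1 := h.eq_conv_response (w := fun n => bdryWindow r p (x n)) (y := fun n =>
    cutNeg m (bdryEmbed r p (bdryWindow r p (x n))) - cutNeg m (x n)) (fun n => by
      simp only [revOp, convCLM_truncate_left, Finset.sum_sub_distrib]
      have := hx n
      simp only [map_sum, revOp] at this
      rw [this, sub_zero]) n
  have h2 := congrArg (bdryWindow r p) h1
  simp only [bdryWindow_truncate_left, map_sum] at h2
  exact h2.symm

/-- The algebraic constraints. -/
theorem Solvable.proj_eq_sum (h : Solvable r p a) (n : ℕ) :
    h.proj n = ∑ k ∈ range (n + 1), (h.proj k).comp (h.proj (n - k)) := by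
  ext1 v
  -- The source of a response is already cut off to `j₁ < 0`, so a further cut changes nothing.
  have h1 := h.conv_proj_of_right (x := fun n => h.response n v) (fun n => by
    rw [h.response_spec]
    ext j
    simp only [cutNeg_apply]
    split_ifs <;> rfl) n
  rw [Finset.Nat.sum_antidiagonal_eq_sum_range_succ
    fun i k => h.proj i (bdryWindow r p (h.response k v))] at h1
  simp only [_root_.sum_apply, ContinuousLinearMap.comp_apply]
  exact h1.symm

/-- The relations satisfied by solutions whose initial data vanish near the boundary. -/
theorem Solvable.proj_window_eq_zero (h : Solvable r p a) {f : Fin (s + 1) → SeqSpace m}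
    {u : ℕ → SeqSpace m} (hf : ∀ (σ : Fin (s + 1)) (j : Idx m), j 0 ≤ (p 0 : ℤ) → f σ j = 0)
    (hu : IsCauchySolution r p a f u) (n : ℕ) (j₁ : ℤ) (hj₁ : j₁ ≤ 0) :
    ∑ k ∈ range (n + 1), h.proj (n - k) (window (p 0 + r 0) (u k) (j₁ + (p 0 : ℤ))) = 0 := by
  -- This shift moves the window with top row `j₁ + p₁` onto the boundary window, whose top row is
  -- `p₁ - 1`.
  set J : Idx m := Fin.cons (j₁ + 1) 0
  have hJ : J 0 = j₁ + 1 := rfl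
  have key := h.conv_proj_of_left (x := fun n => translateCLM J (u n)) (fun n => by
    ext j
    rw [cutNeg_apply, lp.coeFn_zero, Pi.zero_apply, ite_eq_right_iff]
    intro hj
    have hshift : ∀ n, (∑ k ∈ antidiagonal n, revOp r p a k.1 (translateCLM J (u k.2))) j =
        (∑ k ∈ antidiagonal n, revOp r p a k.1 (u k.2)) (j + J) := by
      intro n
      simp only [lp.coeFn_sum, Finset.sum_apply, revOp, convCLM_apply, translateCLM_apply]
      simp only [add_right_comm]
    rw [hshift]
    rcases le_or_gt (s + 1) n with hn | hn
    · obtain ⟨k, rfl⟩ := Nat.exists_eq_add_of_le hn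
      rw [show s + 1 + k = k + s + 1 by omega, conv_revOp_eq_schemeOp, hu.1]
    -- For `n ≤ s` only initial data enter, on rows at most `-1 + (j₁ + 1) + p₁ ≤ p₁`, where they
    -- vanish.
    · simp only [lp.coeFn_sum, Finset.sum_apply]
      refine Finset.sum_eq_zero fun k hk => ?_
      have hk' : k.1 + k.2 = n := by simpa using hk
      have h2 : u k.2 = f ⟨k.2, by omega⟩ := hu.2 ⟨k.2, by omega⟩
      rw [revOp, convCLM_apply]
      refine Finset.sum_eq_zero fun ℓ hℓ => ?_
      have := mem_stencil_zero hℓ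
      rw [h2, hf _ _ (by simp only [Pi.add_apply, hJ]; omega), mul_zero]) n
  rw [← Finset.Nat.sum_antidiagonal_swap, Finset.Nat.sum_antidiagonal_eq_sum_range_succ_mk] at key
  rw [← key]
  refine Finset.sum_congr rfl fun k _ => ?_
  congr 1
  ext j' i
  have hshift : (Fin.cons ((p 0 : ℤ) - 1 - (i : ℕ)) j' : Idx m) + J =
      Fin.cons (j₁ + (p 0 : ℤ) - (i : ℕ)) j' := by
    ext l
    refine Fin.cases ?_ (fun l => ?_) l
    · simp only [Pi.add_apply, Fin.cons_zero, hJ]; omega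
    · simp [J]
  rw [← windowCLM_eq]
  simp only [windowCLM_apply, translateCLM_apply, Prod.snd_swap, hshift]

/-- The leading operator for explicit schemes. -/
theorem Solvable.proj_zero_of_isExplicit (h : Solvable r p a) (he : IsExplicit r p a)
    (v : TangSpace m (p 0 + r 0)) (j : Fin m → ℤ) (i : Fin (p 0 + r 0)) :
    h.proj 0 v j i = if (i : ℕ) < p 0 then 0 else v j i := by
  have hid : ∀ u : SeqSpace m, revOp r p a 0 u = u := fun u =>
    lp.ext ((revOp_zero_apply r p a u).trans (he u))
  have h1 := h.response_spec 0 v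
  simp only [Finset.Nat.antidiagonal_zero, Finset.sum_singleton, hid] at h1
  have h2 := congrArg (fun w : TangSpace m (p 0 + r 0) => w j i)
    (windowCLM_embedCLM (p 0 + r 0) ((p 0 : ℤ) - 1) v)
  simp only [windowCLM_apply] at h2
  rw [Solvable.proj, ContinuousLinearMap.comp_apply, h1, windowCLM_apply, cutNeg_apply, h2,
    Fin.cons_zero]
  -- Component `i` sits in the row `p₁ - 1 - i`, which is negative exactly when `i ≥ p₁`.
  split_ifs <;> first | omega | rfl

/-- Stability bounds the responses uniformly in time. -/
theorem Solvable.exists_norm_response_le (h : Solvable r p a) (hs : StableScheme r p a) :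
    ∃ C : ℝ, ∀ n, ‖h.response n‖ ≤ C := by
  obtain ⟨C, hC, hstab⟩ := hs
  set D : ℝ := √(C * ∑ σ : Fin (s + 1), ‖h.response (σ + 1)‖ ^ 2)
  refine ⟨max D ‖h.response 0‖, fun n => ?_⟩
  rcases n with - | n
  · exact le_max_right _ _
  refine le_trans (ContinuousLinearMap.opNorm_le_bound _ (Real.sqrt_nonneg _) fun w => ?_)
    (le_max_left _ _)
  -- The source of the response equation vanishes from index `s + 2` on. Shifting time by one
  -- therefore gives a solution of the homogeneous scheme; the response at index zero is bounded
  -- separately.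
  have hsol : IsCauchySolution r p a (fun σ => h.response (σ + 1) w)
      (fun n => h.response (n + 1) w) := by
    refine ⟨fun n j => ?_, fun σ => rfl⟩
    have h1 := congrArg (fun u : SeqSpace m => u j) (h.response_spec (n + 1 + s + 1) w)
    simp only at h1
    rw [conv_revOp_eq_schemeOp r p a (fun n => h.response n w), revOp_eq_zero r p a (by omega)] at h1
    simp only [_root_.zero_apply, map_zero, lp.coeFn_zero, Pi.zero_apply] at h1
    rw [← h1]
    refine Finset.sum_congr rfl fun σ _ => ?_
    change schemeOp r p a σ (h.response (n + σ + 1) w) j = _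
    rw [add_right_comm]
  have h2 := hstab _ _ hsol n
  refine le_of_sq_le_sq ?_ (by positivity)
  rw [mul_pow, Real.sq_sqrt (by positivity), mul_assoc, Finset.sum_mul]
  refine h2.trans ?_
  gcongr with σ _
  rw [← mul_pow]
  gcongr
  exact ContinuousLinearMap.le_opNorm _ _

theorem Solvable.summable_norm_proj (h : Solvable r p a) (hs : StableScheme r p a) {δ : ℝ}
    (hδ : 0 < δ) : Summable fun n : ℕ => ‖h.proj n‖ / (1 + δ) ^ n := by
  obtain ⟨C, hC⟩ := h.exists_norm_response_le hs
  have hg : Summable fun n : ℕ => (‖bdryWindow r p‖ * C) * ((1 + δ)⁻¹) ^ n :=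
    (summable_geometric_of_lt_one (by positivity) (inv_lt_one_of_one_lt₀ (by linarith))).mul_left _
  refine .of_nonneg_of_le (fun _ => by positivity) (fun n => ?_) hg
  rw [inv_pow, div_eq_mul_inv]
  gcongr
  exact (ContinuousLinearMap.opNorm_comp_le _ _).trans (by gcongr; exact hC n)

end Response

/-! ### Characters of the lattice -/

section Characters

variable {k : ℕ}

/-- The character `e^{i j·θ}`. -/
def latticeChar (j : Fin k → ℤ) (θ : Fin k → ℝ) : ℂ :=
  Complex.exp (Complex.I * ∑ l, (j l : ℂ) * (θ l : ℂ))

theorem latticeChar_add (i j : Fin k → ℤ) (θ : Fin k → ℝ) :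
    latticeChar (i + j) θ = latticeChar i θ * latticeChar j θ := by
  rw [latticeChar, latticeChar, latticeChar, ← Complex.exp_add, ← mul_add, ← Finset.sum_add_distrib]
  simp [add_mul]

@[simp] theorem latticeChar_zero (θ : Fin k → ℝ) : latticeChar 0 θ = 1 := by
  simp [latticeChar]

theorem latticeChar_neg (j : Fin k → ℤ) (θ : Fin k → ℝ) :
    latticeChar (-j) θ = Complex.exp (-(Complex.I * ∑ l, (j l : ℂ) * (θ l : ℂ))) := by
  simp [latticeChar]

theorem norm_latticeChar (j : Fin k → ℤ) (θ : Fin k → ℝ) : ‖latticeChar j θ‖ = 1 := by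
  have : Complex.I * ∑ l, (j l : ℂ) * (θ l : ℂ) =
      ((∑ l, (j l : ℝ) * θ l : ℝ) : ℂ) * Complex.I := by
    push_cast; ring
  rw [latticeChar, this, Complex.norm_exp_ofReal_mul_I]

theorem conj_latticeChar (j : Fin k → ℤ) (θ : Fin k → ℝ) :
    starRingEnd ℂ (latticeChar j θ) = latticeChar (-j) θ := by
  simp [latticeChar, ← Complex.exp_conj, Complex.conj_ofReal]

@[fun_prop] theorem continuous_latticeChar (j : Fin k → ℤ) : Continuous (latticeChar j) := by
  unfold latticeChar
  fun_prop

theorem latticeChar_cons (j : Fin (k + 1) → ℤ) (ξ : ℝ) (η : Fin k → ℝ) :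
    latticeChar j (Fin.cons ξ η) =
      Complex.exp (Complex.I * ((j 0 : ℂ) * ξ)) * latticeChar (Fin.tail j) η := by
  rw [latticeChar, latticeChar, ← Complex.exp_add, Fin.sum_univ_succ, mul_add]
  rfl

end Characters

/-! ### Symbols of operators bounded below, by damped characters -/

section Symbol

variable {m : ℕ} (r p : Fin (m + 1) → ℕ)

/-- The symbol of `convCLM r p c`. -/
def convSymbol (c : Idx m → ℂ) (θ : Fin (m + 1) → ℝ) : ℂ :=
  ∑ ℓ ∈ stencil r p, c ℓ * latticeChar ℓ θ

@[fun_prop] theorem continuous_convSymbol (c : Idx m → ℂ) : Continuous (convSymbol r p c) := by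
  unfold convSymbol
  fun_prop

theorem summable_exp_neg_abs {ε : ℝ} (hε : 0 < ε) :
    Summable fun j : ℤ => Real.exp (-(ε * |(j : ℝ)|)) := by
  have h : Summable fun n : ℕ => Real.exp (-(ε * n)) := by
    have := Real.summable_exp_nat_mul_iff (a := -ε) |>.2 (by linarith)
    refine this.congr fun n => ?_
    ring_nf
  refine Summable.of_nat_of_neg ?_ ?_ <;> simpa using h

theorem summable_exp_neg_sum_abs {ε : ℝ} (hε : 0 < ε) (k : ℕ) :
    Summable fun j : Fin k → ℤ => Real.exp (-(ε * ∑ l, |(j l : ℝ)|)) := by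
  induction k with
  | zero => exact .of_finite
  | succ k ih =>
    rw [← (Fin.consEquiv fun _ : Fin (k + 1) => ℤ).summable_iff]
    refine ((summable_exp_neg_abs hε).mul_of_nonneg ih (fun _ => (Real.exp_pos _).le)
      (fun _ => (Real.exp_pos _).le)).congr fun x => ?_
    simp [Fin.consEquiv, Fin.sum_univ_succ, ← Real.exp_add]
    ring_nf

/-- The exponentially damped character. -/
def dampedChar (θ : Fin (m + 1) → ℝ) {ε : ℝ} (hε : 0 < ε) : SeqSpace m :=
  ⟨fun j => latticeChar j θ * (Real.exp (-(ε * ∑ l, |(j l : ℝ)|)) : ℂ), by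
    refine memlp_two_iff.2 ((summable_exp_neg_sum_abs (ε := 2 * ε) (by positivity) (m + 1)).congr
      fun j => ?_)
    rw [norm_mul, norm_latticeChar, one_mul, Complex.norm_real, Real.norm_of_nonneg
      (Real.exp_pos _).le, ← Real.exp_nat_mul]
    congr 1
    push_cast
    ring⟩

theorem dampedChar_apply (θ : Fin (m + 1) → ℝ) {ε : ℝ} (hε : 0 < ε) (j : Idx m) :
    dampedChar θ hε j = latticeChar j θ * (Real.exp (-(ε * ∑ l, |(j l : ℝ)|)) : ℂ) := rfl

/-- Since `1 - exp (-t) ≤ exp t - 1`, the upper deviation of `exp (x - y)` from `1` dominates. It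
controls the change of the damping factor under a shift. -/
theorem abs_exp_sub_exp_le {x y t : ℝ} (h : |x - y| ≤ t) :
    |Real.exp x - Real.exp y| ≤ (Real.exp t - 1) * Real.exp y := by
  have h1 : Real.exp x = Real.exp (x - y) * Real.exp y := by rw [← Real.exp_add]; ring_nf
  have h2 := abs_le.1 h
  have h3 : Real.exp (x - y) ≤ Real.exp t := Real.exp_le_exp.2 h2.2
  have h4 : Real.exp (-t) ≤ Real.exp (x - y) := Real.exp_le_exp.2 h2.1
  have h5 : Real.exp (-t) * Real.exp t = 1 := by rw [← Real.exp_add]; simp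
  have h6 : 2 ≤ Real.exp t + Real.exp (-t) := by
    nlinarith [sq_nonneg (Real.exp t - 1), Real.exp_pos t, Real.exp_pos (-t)]
  rw [h1, ← sub_one_mul, abs_mul, abs_of_pos (Real.exp_pos y)]
  gcongr
  rw [abs_le]
  constructor <;> linarith

variable {r p}

/-- The symbol of a finite difference operator that is bounded below on `ℓ²` has no zeros on the
torus. -/
theorem convSymbol_ne_zero_of_bounded_below {c : Idx m → ℂ} {C : ℝ}
    (hC : ∀ w : SeqSpace m, ‖w‖ ≤ C * ‖convCLM r p c w‖) (θ : Fin (m + 1) → ℝ) :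
    convSymbol r p c θ ≠ 0 := by
  intro h0
  -- At a zero of the symbol the operator annihilates the pure character. On the damped one only the
  -- variation of the damping over the stencil survives, of relative size at most `δ ε`. Since `δ ε
  -- → 0` as `ε → 0`, the lower bound fails.
  set δ : ℝ → ℝ := fun ε => ∑ ℓ ∈ stencil r p, ‖c ℓ‖ * (Real.exp (ε * ∑ l, |(ℓ l : ℝ)|) - 1) with hδ
  have key : ∀ ε : ℝ, 0 < ε → 1 ≤ |C| * δ ε := by
    intro ε hε
    have hδ0 : 0 ≤ δ ε := by
      refine Finset.sum_nonneg fun ℓ _ => mul_nonneg (norm_nonneg _) ?_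
      rw [sub_nonneg, Real.one_le_exp_iff]
      positivity
    set w := dampedChar θ hε
    have hw : 0 < ‖w‖ := by
      rw [norm_pos_iff]
      intro h
      have h1 : w 0 = 0 := by rw [h]; rfl
      simp [w, dampedChar_apply] at h1
    have h1 : ‖convCLM r p c w‖ ≤ δ ε * ‖w‖ := by
      have h2 : ‖convCLM r p c w‖ ≤ ‖(δ ε : ℂ) • w‖ := by
        refine lp.norm_mono (by norm_num) fun j => ?_
        have h3 : convCLM r p c w j = latticeChar j θ * ∑ ℓ ∈ stencil r p,
            c ℓ * latticeChar ℓ θ * ((Real.exp (-(ε * ∑ l, |((j + ℓ) l : ℝ)|)) : ℂ) -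
              (Real.exp (-(ε * ∑ l, |(j l : ℝ)|)) : ℂ)) := by
          simp only [mul_sub, Finset.sum_sub_distrib]
          rw [← Finset.sum_mul, show ∑ ℓ ∈ stencil r p, c ℓ * latticeChar ℓ θ = 0 from h0,
            zero_mul, mul_zero, sub_zero, convCLM_apply, Finset.mul_sum]
          refine Finset.sum_congr rfl fun ℓ _ => ?_
          rw [dampedChar_apply, latticeChar_add]
          ring
        rw [h3, norm_mul, norm_latticeChar, one_mul, lp.coeFn_smul, Pi.smul_apply, norm_smul,
          dampedChar_apply, norm_mul, norm_latticeChar, one_mul, Complex.norm_real,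
          Complex.norm_real, Real.norm_of_nonneg hδ0, Real.norm_of_nonneg (Real.exp_pos _).le,
          hδ, Finset.sum_mul]
        refine (norm_sum_le _ _).trans (Finset.sum_le_sum fun ℓ _ => ?_)
        rw [norm_mul, norm_mul, norm_latticeChar, mul_one, mul_assoc, ← Complex.ofReal_sub,
          Complex.norm_real]
        gcongr
        refine abs_exp_sub_exp_le ?_
        rw [neg_sub_neg, ← mul_sub, abs_mul, abs_of_pos hε, ← Finset.sum_sub_distrib]
        gcongr
        refine (Finset.abs_sum_le_sum_abs _ _).trans (Finset.sum_le_sum fun l _ => ?_)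
        have := abs_abs_sub_abs_le_abs_sub (j l : ℝ) ((j + ℓ) l : ℝ)
        simpa using this
      rwa [norm_smul, Complex.norm_real, Real.norm_of_nonneg hδ0] at h2
    have h4 : ‖w‖ ≤ |C| * δ ε * ‖w‖ := by
      calc ‖w‖ ≤ C * ‖convCLM r p c w‖ := hC w
        _ ≤ |C| * (δ ε * ‖w‖) := by
          gcongr
          exact le_abs_self C
        _ = _ := by ring
    exact le_of_mul_le_mul_right (by simpa using h4) hw
  have hcont : Continuous fun ε => |C| * δ ε := by
    simp only [hδ]
    fun_prop
  have h1 : Tendsto (fun ε => |C| * δ ε) (𝓝[>] 0) (𝓝 (|C| * δ 0)) :=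
    (hcont.tendsto 0).mono_left nhdsWithin_le_nhds
  have h2 : (1 : ℝ) ≤ |C| * δ 0 :=
    ge_of_tendsto h1 (eventually_nhdsWithin_of_forall fun ε hε => key ε hε)
  simp [hδ] at h2
  linarith

end Symbol

/-! ### The von Neumann condition from stability -/

section VonNeumann

variable {m s : ℕ} {r p : Fin (m + 1) → ℕ} {a : Coefs m s}

theorem Solvable.convSymbol_revCoef_zero_ne_zero (h : Solvable r p a) (θ : Fin (m + 1) → ℝ) :
    convSymbol r p (revCoef a 0) θ ≠ 0 := by
  refine convSymbol_ne_zero_of_bounded_below (C := ‖h.equiv.symm.toContinuousLinearMap‖)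
    (fun w => ?_) θ
  have h1 := h.equiv.symm.toContinuousLinearMap.le_opNorm (h.equiv w)
  rwa [show h.equiv.symm.toContinuousLinearMap (h.equiv w) = w from
    h.equiv.symm_apply_apply w] at h1

theorem forwardSubst_eq_zero {V : Type*} [AddCommGroup V] {A : ℕ → V → V} {B : V → V}
    (hA : ∀ n, A n 0 = 0) (hB : B 0 = 0) {b : ℕ → V} {n : ℕ} (hb : ∀ k ≤ n, b k = 0) :
    forwardSubst A B b n = 0 := by
  induction n using Nat.strong_induction_on with
  | _ n ih =>
    rw [forwardSubst.eq_1, hb n le_rfl, Finset.sum_eq_zero, sub_zero, hB]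
    intro k _
    rw [ih k k.2 fun l hl => hb l (hl.trans k.2.le), hA]

/-- The coefficients of `L(z) = ∑ z^σ Q_σ`. -/
def resolventCoef (a : Coefs m s) (z : ℂ) (ℓ : Idx m) : ℂ := ∑ σ : Fin (s + 2), z ^ (σ : ℕ) * a ℓ σ

/-- Duhamel's principle: for `g = L(z) w`, both `z^n w` and `R n g` solve the scheme with source
`z^n g`, the latter from zero initial values. Their difference is a Cauchy solution with data `z^σ
w`, bounded by `K ‖w‖` for all `n`. As `|z|^n` outgrows `K`, one fixed `n` controls `w` by `R n g`.
-/
theorem Solvable.resolvent_bounded_below (h : Solvable r p a) (hs : StableScheme r p a) {z : ℂ}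
    (hz : 1 < ‖z‖) : ∃ C : ℝ, ∀ w : SeqSpace m, ‖w‖ ≤ C * ‖convCLM r p (resolventCoef a z) w‖ := by
  obtain ⟨C, hC, hstab⟩ := hs
  set R : ℕ → (SeqSpace m →L[ℂ] SeqSpace m) :=
    forwardSubst (fun i X => (revOp r p a i).comp X)
      (fun X => h.equiv.symm.toContinuousLinearMap.comp X)
      -- The zeros up to `s` produce zero initial values; the exponent is shifted because the scheme
      -- at time `n` sits at index `n + s + 1`.
      (fun n => if n ≤ s then 0 else z ^ (n - (s + 1)) • ContinuousLinearMap.id ℂ (SeqSpace m))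
    with hR
  have hR0 : ∀ n ≤ s, R n = 0 := fun n hn =>
    forwardSubst_eq_zero (by simp) (by simp) fun k hk => by simp [hk.trans hn]
  have hRspec : ∀ n g, ∑ x ∈ antidiagonal (n + s + 1), revOp r p a x.1 (R x.2 g) = z ^ n • g := by
    intro n g
    have h1 := forwardSubst_spec (A := fun i X => (revOp r p a i).comp X)
      (B := fun X => h.equiv.symm.toContinuousLinearMap.comp X)
      (fun X => by
        ext1 v
        exact h.equiv.apply_symm_apply (X v))
      (fun n => if n ≤ s then 0 else z ^ (n - (s + 1)) • ContinuousLinearMap.id ℂ (SeqSpace m))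
      (n + s + 1)
    have h2 := congrArg (fun T : SeqSpace m →L[ℂ] SeqSpace m => T g) h1
    rw [if_neg (by omega), show n + s + 1 - (s + 1) = n by omega] at h2
    simpa [_root_.sum_apply] using h2
  set K : ℝ := √(C * ∑ σ : Fin (s + 1), (‖z‖ ^ (σ : ℕ)) ^ 2)
  have key : ∀ (w : SeqSpace m) (n : ℕ),
      ‖z ^ n • w - R n (convCLM r p (resolventCoef a z) w)‖ ≤ K * ‖w‖ := by
    intro w n
    set g := convCLM r p (resolventCoef a z) w with hg
    have hsol : IsCauchySolution r p a (fun σ => z ^ (σ : ℕ) • w - R σ g)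
        (fun n => z ^ n • w - R n g) := by
      refine ⟨fun n j => ?_, fun σ => rfl⟩
      rw [← conv_revOp_eq_schemeOp r p a (fun n => z ^ n • w - R n g)]
      simp only [map_sub, Finset.sum_sub_distrib]
      rw [hRspec, lp.coeFn_sub, Pi.sub_apply,
        conv_revOp_eq_schemeOp r p a (fun n => z ^ n • w), sub_eq_zero, hg, lp.coeFn_smul,
        Pi.smul_apply, convCLM_apply, smul_eq_mul, Finset.mul_sum]
      simp only [schemeOp, resolventCoef, lp.coeFn_smul, Pi.smul_apply, smul_eq_mul]
      rw [Finset.sum_comm]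
      refine Finset.sum_congr rfl fun ℓ _ => ?_
      rw [Finset.sum_mul, Finset.mul_sum]
      refine Finset.sum_congr rfl fun σ _ => ?_
      ring
    refine le_of_sq_le_sq ((hstab _ _ hsol n).trans (le_of_eq ?_)) (by positivity)
    rw [mul_pow, Real.sq_sqrt (by positivity), mul_assoc, Finset.sum_mul]
    congr 2
    ext σ
    have := σ.2
    rw [hR0 σ (by omega), _root_.zero_apply, sub_zero, norm_smul, norm_pow, mul_pow]
  -- With `|z|^n - K > 1` the term `K ‖w‖` is absorbed and `‖w‖` is left over.
  obtain ⟨n, hn⟩ := pow_unbounded_of_one_lt (K + 1) hz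
  refine ⟨‖R n‖, fun w => ?_⟩
  have h1 := key w n
  have h2 := norm_sub_norm_le (z ^ n • w) (R n (convCLM r p (resolventCoef a z) w))
  have h3 := (R n).le_opNorm (convCLM r p (resolventCoef a z) w)
  rw [norm_smul, norm_pow] at h2
  nlinarith [norm_nonneg w]

/-- The von Neumann condition. -/
theorem Solvable.convSymbol_resolventCoef_ne_zero (h : Solvable r p a) (hs : StableScheme r p a)
    {z : ℂ} (hz : 1 < ‖z‖) (θ : Fin (m + 1) → ℝ) : convSymbol r p (resolventCoef a z) θ ≠ 0 := by
  obtain ⟨C, hC⟩ := h.resolvent_bounded_below hs hz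
  exact convSymbol_ne_zero_of_bounded_below hC θ

end VonNeumann

/-! ### Fourier coefficients on the box and Bessel's inequality -/

section Orthogonality

/-- Lebesgue measure on the box `[-π, π]^k`. -/
abbrev boxMeasure (k : ℕ) : Measure (Fin k → ℝ) :=
  volume.restrict (Set.Icc (fun _ : Fin k => -Real.pi) (fun _ => Real.pi))

/-- Lebesgue measure on `[-π, π]`. -/
abbrev segMeasure : Measure ℝ := volume.restrict (Set.Icc (-Real.pi) Real.pi)

theorem integral_seg_exp (n : ℤ) :
    ∫ x, Complex.exp (Complex.I * ((n : ℂ) * (x : ℂ))) ∂segMeasure =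
      if n = 0 then 2 * (Real.pi : ℂ) else 0 := by
  rw [integral_Icc_eq_integral_Ioc, ← intervalIntegral.integral_of_le (by linarith [Real.pi_pos])]
  split_ifs with h
  · simp [h]; ring
  · have hc : Complex.I * (n : ℂ) ≠ 0 := mul_ne_zero Complex.I_ne_zero (by exact_mod_cast h)
    simp only [← mul_assoc]
    rw [integral_exp_mul_complex hc, div_eq_zero_iff]
    left
    rw [sub_eq_zero, Complex.exp_eq_exp_iff_exists_int]
    exact ⟨n, by push_cast; ring⟩

theorem integral_box_latticeChar {k : ℕ} (j : Fin k → ℤ) :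
    ∫ η, latticeChar j η ∂boxMeasure k = if j = 0 then (2 * (Real.pi : ℂ)) ^ k else 0 := by
  have h1 : ∀ η : Fin k → ℝ, latticeChar j η =
      ∏ l, Complex.exp (Complex.I * ((j l : ℂ) * (η l : ℂ))) := by
    intro η
    rw [latticeChar, Finset.mul_sum, Complex.exp_sum]
  simp only [h1]
  rw [boxMeasure, ← Set.pi_univ_Icc, volume_pi, Measure.restrict_pi_pi,
    integral_fintype_prod_eq_prod (fun l (x : ℝ) => Complex.exp (Complex.I * ((j l : ℂ) * (x : ℂ))))]
  simp only [integral_seg_exp]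
  split_ifs with h
  · simp [h]
  · obtain ⟨l, hl⟩ := Function.ne_iff.1 h
    exact Finset.prod_eq_zero (Finset.mem_univ l) (if_neg hl)

/-- Lebesgue measure on `[-π, π]^{d-1} × [-π, π]`. -/
abbrev torusMeasure (m : ℕ) : Measure ((Fin m → ℝ) × ℝ) := (boxMeasure m).prod segMeasure

/-- The point of `ℝ^d` with tangential part `x.1` and normal part `x.2`. -/
abbrev freq {m : ℕ} (x : (Fin m → ℝ) × ℝ) : Fin (m + 1) → ℝ := Fin.cons x.2 x.1

@[fun_prop] theorem continuous_freq {m : ℕ} : Continuous (freq (m := m)) :=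
  Continuous.finCons (A := fun _ => ℝ) continuous_snd continuous_fst

variable {m : ℕ}

theorem Continuous.integrable_torus {E : Type*} [NormedAddCommGroup E]
    {F : (Fin m → ℝ) × ℝ → E} (hF : Continuous F) : Integrable F (torusMeasure m) := by
  rw [torusMeasure, Measure.prod_restrict]
  exact hF.continuousOn.integrableOn_compact (isCompact_Icc.prod isCompact_Icc)

theorem Continuous.integrable_seg {E : Type*} [NormedAddCommGroup E]
    {F : ℝ → E} (hF : Continuous F) : Integrable F segMeasure :=
  hF.continuousOn.integrableOn_compact isCompact_Icc

theorem Continuous.memLp_torus {F : (Fin m → ℝ) × ℝ → ℂ} (hF : Continuous F) :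
    MemLp F 2 (torusMeasure m) := by
  rw [memLp_two_iff_integrable_sq_norm hF.integrable_torus.1]
  exact Continuous.integrable_torus (by fun_prop)

theorem integral_torus_latticeChar (j : Idx m) :
    ∫ x, latticeChar j (freq x) ∂torusMeasure m =
      if j = 0 then (2 * (Real.pi : ℂ)) ^ (m + 1) else 0 := by
  simp only [freq, latticeChar_cons]
  rw [← integral_prod_swap]
  simp only [Prod.snd_swap, Prod.fst_swap]
  rw [integral_prod_mul (μ := segMeasure) (ν := boxMeasure m)
    (fun ξ : ℝ => Complex.exp (Complex.I * ((j 0 : ℂ) * ξ))) (latticeChar (Fin.tail j)),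
    integral_seg_exp, integral_box_latticeChar]
  by_cases h0 : j 0 = 0
  · by_cases h1 : Fin.tail j = 0
    · have : j = 0 := by
        rw [← Fin.cons_self_tail j, h0, h1]
        ext l
        refine Fin.cases rfl (fun _ => rfl) l
      rw [if_pos h0, if_pos h1, if_pos this]
      ring
    · have : j ≠ 0 := fun h => h1 (by rw [h]; rfl)
      simp [h1, this]
  · have : j ≠ 0 := fun h => h0 (by rw [h]; rfl)
    simp [h0, this]

/-- The (unnormalized) Fourier coefficients of a function on the box. -/
def torusCoeff (F : (Fin m → ℝ) × ℝ → ℂ) (j : Idx m) : ℂ :=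
  ∫ x, latticeChar j (freq x) * F x ∂torusMeasure m

/-- Bessel's inequality. -/
theorem memlp_torusCoeff {F : (Fin m → ℝ) × ℝ → ℂ} (hF : Continuous F) :
    Memℓp (torusCoeff F) 2 := by
  set κ : ℝ := √((2 * Real.pi) ^ (m + 1)) with hκ
  have hκ0 : (κ : ℂ) ≠ 0 := by
    rw [Ne, Complex.ofReal_eq_zero, hκ, Real.sqrt_eq_zero']
    have := Real.pi_pos
    push Not
    positivity
  have hκ2 : (κ : ℂ) * κ = (2 * (Real.pi : ℂ)) ^ (m + 1) := by
    rw [← Complex.ofReal_mul, hκ, Real.mul_self_sqrt (by positivity)]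
    push_cast
    ring
  have hc : ∀ j : Idx m, Continuous fun x : (Fin m → ℝ) × ℝ =>
      (κ : ℂ)⁻¹ * latticeChar (-j) (freq x) := fun j => by fun_prop
  -- The inner product conjugates its first argument, so the character of `-j` produces the
  -- coefficient at `j`; `κ` normalizes by the volume of the box.
  set v : Idx m → Lp ℂ 2 (torusMeasure m) := fun j => (hc j).memLp_torus.toLp _ with hv
  have hinner : ∀ (j : Idx m) {G : (Fin m → ℝ) × ℝ → ℂ} (hG : MemLp G 2 (torusMeasure m)),
      inner ℂ (v j) (hG.toLp G) = (κ : ℂ)⁻¹ * ∫ x, latticeChar j (freq x) * G x ∂torusMeasure m := by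
    intro j G hG
    rw [L2.inner_def, ← integral_const_mul]
    refine integral_congr_ae ?_
    filter_upwards [(hc j).memLp_torus.coeFn_toLp, hG.coeFn_toLp] with x h1 h2
    rw [hv]
    simp only
    rw [h1, h2, RCLike.inner_apply, map_mul, conj_latticeChar, neg_neg, map_inv₀,
      Complex.conj_ofReal]
    ring
  have hon : Orthonormal ℂ v := by
    rw [orthonormal_iff_ite]
    intro i j
    rw [show v j = (hc j).memLp_torus.toLp _ from rfl, hinner]
    have h1 : ∀ x : (Fin m → ℝ) × ℝ, latticeChar i (freq x) * ((κ : ℂ)⁻¹ * latticeChar (-j) (freq x))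
        = (κ : ℂ)⁻¹ * latticeChar (i - j) (freq x) := fun x => by
      rw [sub_eq_add_neg, latticeChar_add]; ring
    simp only [h1]
    rw [integral_const_mul, integral_torus_latticeChar]
    simp only [sub_eq_zero]
    split_ifs
    · rw [← hκ2]; field_simp
    · simp
  have h2 := hon.inner_products_summable (x := hF.memLp_torus.toLp F)
  refine memlp_two_iff.2 ((h2.mul_left (‖(κ : ℂ)‖ ^ 2)).congr fun j => ?_)
  rw [hinner, norm_mul, mul_pow, ← mul_assoc, ← mul_pow, ← norm_mul, mul_inv_cancel₀ hκ0]
  simp [torusCoeff]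

/-- The sequence of Fourier coefficients of a continuous function on the box. -/
def torusSeq {F : (Fin m → ℝ) × ℝ → ℂ} (hF : Continuous F) : SeqSpace m :=
  ⟨fun j => ((2 * (Real.pi : ℂ)) ^ (m + 1))⁻¹ * torusCoeff F j, (memlp_torusCoeff hF).const_mul _⟩

theorem torusSeq_apply {F : (Fin m → ℝ) × ℝ → ℂ} (hF : Continuous F) (j : Idx m) :
    torusSeq hF j = ((2 * (Real.pi : ℂ)) ^ (m + 1))⁻¹ * torusCoeff F j := rfl

theorem torusCoeff_sum {ι : Type*} (t : Finset ι) {F : ι → (Fin m → ℝ) × ℝ → ℂ}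
    (hF : ∀ i ∈ t, Continuous (F i)) (j : Idx m) :
    torusCoeff (fun x => ∑ i ∈ t, F i x) j = ∑ i ∈ t, torusCoeff (F i) j := by
  simp only [torusCoeff, Finset.mul_sum]
  refine integral_finsetSum _ fun i hi => Continuous.integrable_torus ?_
  have := hF i hi
  fun_prop

theorem torusCoeff_const_mul (c : ℂ) (F : (Fin m → ℝ) × ℝ → ℂ) (j : Idx m) :
    torusCoeff (fun x => c * F x) j = c * torusCoeff F j := by
  simp only [torusCoeff, mul_left_comm _ c]
  exact integral_const_mul _ _

theorem torusCoeff_latticeChar_mul (i : Idx m) (F : (Fin m → ℝ) × ℝ → ℂ) (j : Idx m) :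
    torusCoeff (fun x => latticeChar i (freq x) * F x) j = torusCoeff F (j + i) := by
  simp only [torusCoeff, latticeChar_add, mul_assoc]

theorem torusCoeff_latticeChar (i j : Idx m) :
    torusCoeff (fun x => latticeChar i (freq x)) j =
      if j + i = 0 then (2 * (Real.pi : ℂ)) ^ (m + 1) else 0 := by
  simp only [torusCoeff, ← latticeChar_add]
  exact integral_torus_latticeChar _

theorem convCLM_torusSeq {r p : Fin (m + 1) → ℕ} (c : Idx m → ℂ) {F : (Fin m → ℝ) × ℝ → ℂ}
    (hF : Continuous F) (j : Idx m) :
    convCLM r p c (torusSeq hF) j = ((2 * (Real.pi : ℂ)) ^ (m + 1))⁻¹ *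
      torusCoeff (fun x => convSymbol r p c (freq x) * F x) j := by
  simp only [convSymbol, Finset.sum_mul, mul_assoc]
  rw [torusCoeff_sum _ fun ℓ _ => by fun_prop]
  simp only [torusCoeff_const_mul, torusCoeff_latticeChar_mul]
  rw [convCLM_apply, Finset.mul_sum]
  refine Finset.sum_congr rfl fun ℓ _ => ?_
  rw [torusSeq_apply]
  ring

end Orthogonality

/-! ### The symbol of the boundary source -/

section BoundarySymbol

variable {m s : ℕ} (r p : Fin (m + 1) → ℕ)

/-- The boundary site that carries the component `b`. -/
def bdrySite (m P : ℕ) (b : ℕ) : Idx m := Fin.cons ((P : ℤ) - 1 - b) 0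

/-- The symbol of `1_{j₁<0} C ι` acting on the component `b`. -/
def bdrySymbol (c : Idx m → ℂ) (b : ℕ) (θ : Fin (m + 1) → ℝ) : ℂ :=
  ∑ ℓ ∈ stencil r p, if (bdrySite m (p 0) b - ℓ) 0 < 0 then
    c ℓ * latticeChar (ℓ - bdrySite m (p 0) b) θ else 0

@[fun_prop] theorem continuous_bdrySymbol (c : Idx m → ℂ) (b : ℕ) :
    Continuous (bdrySymbol r p c b) := by
  unfold bdrySymbol
  refine continuous_finsetSum _ fun ℓ _ => ?_
  split_ifs <;> fun_prop

theorem tangFourier_eq_sum {N : ℕ} {v : TangSpace m N}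
    (hv : (Function.support (v : (Fin m → ℤ) → EuclideanSpace ℂ (Fin N))).Finite) (η : Fin m → ℝ)
    (b : Fin N) : tangFourier v η b = ∑ k ∈ hv.toFinset, latticeChar (-k) η * v k b := by
  rw [tangFourier, tsum_eq_sum (s := hv.toFinset)]
  · simp only [latticeChar_neg]
  · intro k hk
    have : v k = 0 := by simpa using hk
    simp [this]

theorem continuous_tangFourier {N : ℕ} {v : TangSpace m N}
    (hv : (Function.support (v : (Fin m → ℤ) → EuclideanSpace ℂ (Fin N))).Finite) (b : Fin N) :
    Continuous fun η => tangFourier v η b := by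
  simp only [tangFourier_eq_sum hv]
  fun_prop

/-- For finitely supported `v` all sums are finite, and orthogonality of characters retains only the
terms with `j + ℓ` in the row of component `b`. For these the site minus `ℓ` lies in the row of `j`,
so the condition in `bdrySymbol` is the cut-off `j₁ < 0`. -/
theorem cutNeg_convCLM_bdryEmbed_apply (c : Idx m → ℂ) {v : TangSpace m (p 0 + r 0)}
    (hv : (Function.support
      (v : (Fin m → ℤ) → EuclideanSpace ℂ (Fin (p 0 + r 0)))).Finite) (j : Idx m) :
    cutNeg m (convCLM r p c (bdryEmbed r p v)) j = ((2 * (Real.pi : ℂ)) ^ (m + 1))⁻¹ *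
      torusCoeff (fun x => ∑ b : Fin (p 0 + r 0),
        bdrySymbol r p c b (freq x) * tangFourier v x.1 b) j := by
  have hpi : (2 * (Real.pi : ℂ)) ^ (m + 1) ≠ 0 := by
    exact pow_ne_zero _ (mul_ne_zero two_ne_zero (by exact_mod_cast Real.pi_pos.ne'))
  have hpush : ∀ (k : Fin m → ℤ) (x : (Fin m → ℝ) × ℝ),
      latticeChar (-k) x.1 = latticeChar (Fin.cons 0 (-k)) (freq x) := by
    intro k x
    rw [freq, latticeChar_cons]
    simp
  have hval : ∀ (b : Fin (p 0 + r 0)), torusCoeff (fun x =>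
      bdrySymbol r p c b (freq x) * tangFourier v x.1 b) j =
      ∑ ℓ ∈ stencil r p, ∑ k ∈ hv.toFinset, if (bdrySite m (p 0) b - ℓ) 0 < 0 then
        c ℓ * v k b * (if j + (ℓ - bdrySite m (p 0) b + Fin.cons 0 (-k)) = 0 then
          (2 * (Real.pi : ℂ)) ^ (m + 1) else 0) else 0 := by
    intro b
    simp only [bdrySymbol, tangFourier_eq_sum hv, Finset.sum_mul, hpush]
    rw [torusCoeff_sum _ fun ℓ _ => by split_ifs <;> fun_prop]
    refine Finset.sum_congr rfl fun ℓ _ => ?_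
    simp only [Finset.mul_sum]
    rw [torusCoeff_sum _ fun ℓ _ => by split_ifs <;> fun_prop]
    refine Finset.sum_congr rfl fun k _ => ?_
    by_cases h1 : (bdrySite m (p 0) b - ℓ) 0 < 0
    · simp only [if_pos h1]
      rw [← torusCoeff_latticeChar, ← torusCoeff_const_mul]
      congr 1
      ext x
      rw [latticeChar_add]
      ring
    · simp only [if_neg h1, zero_mul, torusCoeff, mul_zero, integral_zero]
  rw [torusCoeff_sum _ fun b _ => ?_]
  swap
  · have := continuous_tangFourier hv b
    fun_prop
  simp only [hval]
  have hcond : ∀ (b : Fin (p 0 + r 0)) (ℓ : Idx m) (k : Fin m → ℤ),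
      j + (ℓ - bdrySite m (p 0) b + Fin.cons 0 (-k)) = 0 ↔
        (j + ℓ) 0 = (p 0 : ℤ) - 1 - (b : ℕ) ∧ k = Fin.tail (j + ℓ) := by
    intro b ℓ k
    constructor
    · intro h
      constructor
      · have := congrFun h 0
        simp [bdrySite] at this ⊢
        linarith
      · ext l
        have := congrFun h l.succ
        simp [bdrySite, Fin.tail] at this ⊢
        linarith
    · rintro ⟨h1, h2⟩
      ext l
      refine Fin.cases ?_ (fun l => ?_) l
      · simp [bdrySite] at h1 ⊢
        linarith
      · simp [bdrySite, h2, Fin.tail]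
  have hterm : ∀ (b : Fin (p 0 + r 0)) (ℓ : Idx m), ∑ k ∈ hv.toFinset,
      ((2 * (Real.pi : ℂ)) ^ (m + 1))⁻¹ * (if (bdrySite m (p 0) b - ℓ) 0 < 0 then
        c ℓ * v k b * (if j + (ℓ - bdrySite m (p 0) b + Fin.cons 0 (-k)) = 0 then
          (2 * (Real.pi : ℂ)) ^ (m + 1) else 0) else 0) =
      if j 0 < 0 then c ℓ * (if (j + ℓ) 0 = (p 0 : ℤ) - 1 - (b : ℕ) then
        v (Fin.tail (j + ℓ)) b else 0) else 0 := by
    intro b ℓ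
    simp only [hcond]
    by_cases h0 : (j + ℓ) 0 = (p 0 : ℤ) - 1 - (b : ℕ)
    · have h1 : (bdrySite m (p 0) b - ℓ) 0 = j 0 := by
        simp [bdrySite] at h0 ⊢
        linarith
      simp only [h0, h1, true_and, if_true]
      rw [Finset.sum_eq_single (Fin.tail (j + ℓ))]
      · split_ifs with h2 h3
        · field_simp
        · exact absurd rfl h3
        · simp
      · intro k _ hk
        simp [hk]
      · intro hk
        have : v (Fin.tail (j + ℓ)) = 0 := by simpa using hk
        simp [this]
    · simp only [h0, false_and, if_false, mul_zero, ite_self, Finset.sum_const_zero]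
  simp only [Finset.mul_sum, hterm]
  rw [Finset.sum_comm, cutNeg_apply, convCLM_apply]
  by_cases hj : j 0 < 0
  · simp only [hj, if_true, embedCLM_apply, Finset.mul_sum]
  · simp [hj]

end BoundarySymbol

/-! ### Responses and `Π_n` as Fourier multipliers -/

section ResponseSymbol

variable {m s : ℕ} (r p : Fin (m + 1) → ℕ) (a : Coefs m s)

/-- The symbol of the response operators. -/
def responseSymbol (n b : ℕ) (θ : Fin (m + 1) → ℝ) : ℂ :=
  forwardSubst (fun i y => convSymbol r p (revCoef a i) θ * y)
    (fun y => (convSymbol r p (revCoef a 0) θ)⁻¹ * y)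
    (fun n => bdrySymbol r p (revCoef a n) b θ) n

variable {r p a}

theorem Solvable.responseSymbol_spec (h : Solvable r p a) (n b : ℕ) (θ : Fin (m + 1) → ℝ) :
    ∑ x ∈ antidiagonal n, convSymbol r p (revCoef a x.1) θ * responseSymbol r p a x.2 b θ =
      bdrySymbol r p (revCoef a n) b θ :=
  forwardSubst_spec (A := fun i y => convSymbol r p (revCoef a i) θ * y)
    (fun y => by rw [mul_inv_cancel_left₀ (h.convSymbol_revCoef_zero_ne_zero θ)])
    (fun n => bdrySymbol r p (revCoef a n) b θ) n

theorem Solvable.continuous_responseSymbol (h : Solvable r p a) (n b : ℕ) :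
    Continuous (responseSymbol r p a n b) := by
  induction n using Nat.strong_induction_on with
  | _ n ih =>
    have h1 : responseSymbol r p a n b = fun θ => (convSymbol r p (revCoef a 0) θ)⁻¹ *
        (bdrySymbol r p (revCoef a n) b θ - ∑ k : Fin n,
          convSymbol r p (revCoef a (n - k)) θ * responseSymbol r p a k b θ) := by
      ext θ
      exact forwardSubst.eq_1 _ _ _ _
    rw [h1]
    have h2 : ∀ k : Fin n, Continuous (responseSymbol r p a k b) := fun k => ih k k.2
    refine Continuous.mul (Continuous.inv₀ (by fun_prop) h.convSymbol_revCoef_zero_ne_zero) ?_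
    fun_prop

/-- Both sides solve the same triangular equation. Bessel's inequality puts the Fourier coefficients
in `ℓ²`, which is where uniqueness is available. -/
theorem Solvable.response_eq_torusCoeff (h : Solvable r p a) {v : TangSpace m (p 0 + r 0)}
    (hv : (Function.support
      (v : (Fin m → ℤ) → EuclideanSpace ℂ (Fin (p 0 + r 0)))).Finite) (n : ℕ) (j : Idx m) :
    h.response n v j = ((2 * (Real.pi : ℂ)) ^ (m + 1))⁻¹ * torusCoeff (fun x =>
      ∑ b : Fin (p 0 + r 0), responseSymbol r p a n b (freq x) * tangFourier v x.1 b) j := by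
  have hF : ∀ n, Continuous fun x : (Fin m → ℝ) × ℝ =>
      ∑ b : Fin (p 0 + r 0), responseSymbol r p a n b (freq x) * tangFourier v x.1 b := by
    intro n
    refine continuous_finsetSum _ fun b _ => ?_
    have h1 := h.continuous_responseSymbol n b
    have h2 := continuous_tangFourier hv b
    fun_prop
  have key : ∀ n, ∑ x ∈ antidiagonal n, revOp r p a x.1 (torusSeq (hF x.2)) =
      cutNeg m (revOp r p a n (bdryEmbed r p v)) := by
    intro n
    ext j
    rw [revOp, cutNeg_convCLM_bdryEmbed_apply r p _ hv, lp.coeFn_sum, Finset.sum_apply]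
    simp only [revOp, convCLM_torusSeq]
    rw [← Finset.mul_sum, ← torusCoeff_sum _ fun x _ => by
      have := hF x.2
      fun_prop]
    congr 2
    ext x
    simp only [← h.responseSymbol_spec, Finset.mul_sum, Finset.sum_mul]
    rw [Finset.sum_comm]
    simp only [mul_assoc]
  have h1 := eq_zero_of_conv_eq_zero (A := fun i => (revOp r p a i).toLinearMap)
    (y := fun n => h.response n v - torusSeq (hF n)) h.bijective.1 (fun n => by
      simp only [ContinuousLinearMap.coe_coe, map_sub, Finset.sum_sub_distrib]
      rw [h.response_spec, key, sub_self]) n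
  rw [sub_eq_zero] at h1
  rw [h1, torusSeq_apply]

variable (r p a) in
/-- The symbol of `Π_n`. -/
def projSymbol (n : ℕ) (η : Fin m → ℝ) : Matrix (Fin (p 0 + r 0)) (Fin (p 0 + r 0)) ℂ :=
  Matrix.of fun i b => (2 * (Real.pi : ℂ))⁻¹ * ∫ ξ, Complex.exp (Complex.I *
    ((((p 0 : ℤ) - 1 - (i : ℕ) : ℤ) : ℂ) * (ξ : ℂ))) *
      responseSymbol r p a n b (Fin.cons ξ η) ∂segMeasure

theorem continuous_integral_seg {F : (Fin m → ℝ) → ℝ → ℂ} (hF : Continuous (Function.uncurry F)) :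
    Continuous fun η => ∫ ξ, F η ξ ∂segMeasure :=
  continuous_parametric_integral_of_continuous hF isCompact_Icc

theorem Solvable.continuous_projSymbol (h : Solvable r p a) (n : ℕ) :
    Continuous (projSymbol r p a n) := by
  refine continuous_matrix fun i b => ?_
  refine continuous_const.mul (continuous_integral_seg ?_)
  have h1 := h.continuous_responseSymbol n b
  have h2 : Continuous fun x : (Fin m → ℝ) × ℝ => responseSymbol r p a n b (freq x) := by fun_prop
  exact Continuous.mul (by fun_prop) h2

/-- By Fubini the normal frequency is integrated first. The transform of `v` does not depend on it,
so evaluation at the row `p₁ - 1 - i` leaves the entries of the symbol. -/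
theorem Solvable.isFourierMultiplier (h : Solvable r p a) (n : ℕ) :
    IsFourierMultiplier (projSymbol r p a n) (h.proj n) := by
  intro v hv j i
  have hc : ∀ b : Fin (p 0 + r 0), Continuous fun x : (Fin m → ℝ) × ℝ =>
      responseSymbol r p a n b (freq x) := fun b => by
    have h1 := h.continuous_responseSymbol n b
    fun_prop
  have hF : Continuous fun x : (Fin m → ℝ) × ℝ =>
      ∑ b : Fin (p 0 + r 0), responseSymbol r p a n b (freq x) * tangFourier v x.1 b := by
    refine continuous_finsetSum _ fun b _ => ?_
    have h1 := hc b
    have h2 := continuous_tangFourier hv b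
    fun_prop
  rw [Solvable.proj, ContinuousLinearMap.comp_apply, windowCLM_apply,
    h.response_eq_torusCoeff hv, torusCoeff, integral_prod _ (by
      exact Continuous.integrable_torus (by fun_prop)), pow_succ, mul_inv, mul_assoc]
  congr 1
  rw [← integral_const_mul]
  congr 1
  ext η
  change _ = latticeChar j η * _
  simp only [freq, latticeChar_cons, Fin.cons_zero, Fin.tail_cons, Matrix.mulVec, dotProduct,
    projSymbol, Matrix.of_apply, Finset.mul_sum]
  rw [integral_finsetSum _ fun b _ => ?_, Finset.mul_sum]
  · refine Finset.sum_congr rfl fun b _ => ?_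
    have h1 : ∀ ξ : ℝ, Complex.exp (Complex.I * ((((p 0 : ℤ) - 1 - (i : ℕ) : ℤ) : ℂ) * (ξ : ℂ))) *
        latticeChar j η * (responseSymbol r p a n b (Fin.cons ξ η) * tangFourier v η b) =
        (latticeChar j η * tangFourier v η b) *
          (Complex.exp (Complex.I * ((((p 0 : ℤ) - 1 - (i : ℕ) : ℤ) : ℂ) * (ξ : ℂ))) *
            responseSymbol r p a n b (Fin.cons ξ η)) := fun ξ => by ring
    simp only [h1]
    rw [integral_const_mul]
    ring
  · refine Continuous.integrable_seg ?_
    have h1 : Continuous fun ξ : ℝ => responseSymbol r p a n b (Fin.cons ξ η) :=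
      (hc b).comp (g := fun x => responseSymbol r p a n b (freq x)) (f := fun ξ : ℝ => (η, ξ))
        (by fun_prop)
    fun_prop

end ResponseSymbol

/-! ### Growth of Taylor coefficients of rational functions -/

section Growth

/-- A solution of `(1 - ρ X) x = y` with `‖ρ‖ ≤ 1` grows at most one power faster than `y`. -/
theorem norm_coeff_le_of_one_sub_mul {ρ : ℂ} (hρ : ‖ρ‖ ≤ 1) {x : PowerSeries ℂ} {A : ℝ} {k : ℕ}
    (hx : ∀ n, ‖PowerSeries.coeff n ((1 - PowerSeries.C ρ * PowerSeries.X) * x)‖ ≤ A * (n + 1) ^ k)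
    (n : ℕ) : ‖PowerSeries.coeff n x‖ ≤ A * (n + 1) ^ (k + 1) := by
  have hA : 0 ≤ A := by simpa using (norm_nonneg _).trans (hx 0)
  induction n with
  | zero => simpa [sub_mul, mul_assoc] using hx 0
  | succ n ih =>
    have h1 := hx (n + 1)
    have h2 : PowerSeries.coeff (n + 1) ((1 - PowerSeries.C ρ * PowerSeries.X) * x) =
        PowerSeries.coeff (n + 1) x - ρ * PowerSeries.coeff n x := by
      rw [sub_mul, one_mul, mul_assoc, map_sub, PowerSeries.coeff_C_mul,
        PowerSeries.coeff_succ_X_mul]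
    rw [h2] at h1
    have h3 : ‖PowerSeries.coeff (n + 1) x‖ ≤
        ‖PowerSeries.coeff (n + 1) x - ρ * PowerSeries.coeff n x‖ +
          ‖ρ * PowerSeries.coeff n x‖ := by
      simpa using norm_add_le (PowerSeries.coeff (n + 1) x - ρ * PowerSeries.coeff n x)
        (ρ * PowerSeries.coeff n x)
    have h4 : ‖ρ * PowerSeries.coeff n x‖ ≤ ‖PowerSeries.coeff n x‖ := by
      rw [norm_mul]
      exact mul_le_of_le_one_left (norm_nonneg _) hρ
    have h5 : ((n : ℝ) + 1) ^ k ≤ ((n : ℝ) + 1 + 1) ^ k := by gcongr; linarith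
    push_cast at h1 ⊢
    have h6 : A * ((n : ℝ) + 1) ^ (k + 1) ≤ A * (((n : ℝ) + 1 + 1) ^ k * ((n : ℝ) + 1)) := by
      rw [pow_succ]
      gcongr
    calc _ ≤ A * ((n : ℝ) + 1 + 1) ^ k + A * (((n : ℝ) + 1 + 1) ^ k * ((n : ℝ) + 1)) := by linarith
      _ = _ := by ring

theorem norm_coeff_le_of_prod_mul (R : Multiset ℂ) (hR : ∀ ρ ∈ R, ‖ρ‖ ≤ 1) {A : ℝ} (k : ℕ)
    (x : PowerSeries ℂ)
    (hx : ∀ n, ‖PowerSeries.coeff n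
      ((R.map fun ρ => 1 - PowerSeries.C ρ * PowerSeries.X).prod * x)‖ ≤ A * (n + 1) ^ k) (n : ℕ) :
    ‖PowerSeries.coeff n x‖ ≤ A * (n + 1) ^ (k + Multiset.card R) := by
  induction R using Multiset.induction_on generalizing k with
  | empty => simpa using hx n
  | cons ρ R ih =>
    rw [Multiset.card_cons, add_comm (Multiset.card R) 1, ← add_assoc]
    refine ih (fun σ hσ => hR σ (Multiset.mem_cons_of_mem hσ)) (k + 1) fun n => ?_
    refine norm_coeff_le_of_one_sub_mul (hR ρ (Multiset.mem_cons_self _ _)) (fun n => ?_) n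
    simpa [mul_assoc] using hx n

/-- The coefficients of `c / g` grow polynomially when `g` has no zeros in the open unit disk. -/
theorem norm_le_of_conv_le (g : Polynomial ℂ) (hg : ∀ X : ℂ, ‖X‖ < 1 → g.eval X ≠ 0) {x : ℕ → ℂ}
    {A : ℝ} (hx : ∀ n, ‖∑ i ∈ antidiagonal n, g.coeff i.1 * x i.2‖ ≤ A) (n : ℕ) :
    ‖x n‖ ≤ A / ‖g.coeff 0‖ * (n + 1) ^ g.natDegree := by
  have hg0 : g.coeff 0 ≠ 0 := by
    rw [Polynomial.coeff_zero_eq_eval_zero]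
    exact hg 0 (by simp)
  have hgne : g ≠ 0 := fun h => hg0 (by simp [h])
  have hroots : ∀ ρ ∈ g.roots, 1 ≤ ‖ρ‖ := fun ρ hρ =>
    not_lt.1 fun h => hg ρ h (Polynomial.isRoot_of_mem_roots hρ)
  have hsplit := (IsAlgClosed.splits g).eq_prod_roots
  -- All roots have modulus at least one, so `g` is a constant times factors `1 - ρ⁻¹ X` with `|ρ⁻¹|
  -- ≤ 1`; dividing by each costs one power of `n + 1`.
  have hfac : g = Polynomial.C (g.leadingCoeff * (g.roots.map fun ρ => -ρ).prod) *
      (g.roots.map fun ρ => 1 - Polynomial.C ρ⁻¹ * Polynomial.X).prod := by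
    rw [Polynomial.C_mul, mul_assoc, ← Multiset.prod_hom _ Polynomial.C, Multiset.map_map,
      ← Multiset.prod_map_mul]
    conv_lhs => rw [hsplit]
    congr 2
    refine Multiset.map_congr rfl fun ρ hρ => ?_
    have hρ0 : ρ ≠ 0 := by
      rintro rfl
      simpa using (hroots 0 hρ).trans_lt' one_pos
    simp only [Function.comp, Polynomial.C_neg, mul_sub, mul_one, neg_mul, ← mul_assoc,
      ← Polynomial.C_mul, mul_inv_cancel₀ hρ0]
    simp
    ring
  have hlead : g.leadingCoeff * (g.roots.map fun ρ => -ρ).prod = g.coeff 0 := by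
    conv_rhs => rw [hfac]
    rw [Polynomial.coeff_C_mul, Polynomial.coeff_zero_multiset_prod, Multiset.map_map]
    simp
  rw [hlead] at hfac
  have hps : (g : PowerSeries ℂ) = PowerSeries.C (g.coeff 0) *
      ((g.roots.map fun ρ => ρ⁻¹).map fun ρ => 1 - PowerSeries.C ρ * PowerSeries.X).prod := by
    conv_lhs => rw [hfac]
    rw [Polynomial.coe_mul, Polynomial.coe_C, Multiset.map_map]
    congr 1
    rw [← Polynomial.coeToPowerSeries.ringHom_apply, map_multiset_prod, Multiset.map_map]
    congr 1
    refine Multiset.map_congr rfl fun ρ _ => ?_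
    simp
  have hcard : Multiset.card (g.roots.map fun ρ => ρ⁻¹) = g.natDegree := by
    rw [Multiset.card_map]
    exact (IsAlgClosed.splits g).natDegree_eq_card_roots.symm
  have h := norm_coeff_le_of_prod_mul (g.roots.map fun ρ => ρ⁻¹) (fun ρ hρ => by
    obtain ⟨σ, hσ, rfl⟩ := Multiset.mem_map.1 hρ
    rw [norm_inv]
    exact inv_le_one_of_one_le₀ (hroots σ hσ)) (A := A / ‖g.coeff 0‖) 0 (PowerSeries.mk x)
    (fun n => by
      have h1 := hx n
      have h2 : ∑ i ∈ antidiagonal n, g.coeff i.1 * x i.2 =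
          PowerSeries.coeff n ((g : PowerSeries ℂ) * PowerSeries.mk x) := by
        rw [PowerSeries.coeff_mul]
        simp
      rw [h2, hps, mul_assoc, PowerSeries.coeff_C_mul, norm_mul] at h1
      rw [pow_zero, mul_one, le_div_iff₀ (norm_pos_iff.2 hg0), mul_comm]
      exact h1) n
  rw [zero_add, hcard] at h
  simpa using h

theorem summable_succ_pow_mul_geometric (k : ℕ) {q : ℝ} (h0 : 0 ≤ q) (h1 : q < 1) :
    Summable fun n : ℕ => ((n : ℝ) + 1) ^ k * q ^ n := by
  rcases h0.eq_or_lt with rfl | h0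
  · exact summable_of_ne_finset_zero (s := {0}) fun n hn => by
      rw [zero_pow (by simpa using hn), mul_zero]
  have h := (summable_nat_add_iff 1).2 (summable_pow_mul_geometric_of_norm_lt_one (R := ℝ) k
    (r := q) (by rwa [Real.norm_of_nonneg h0.le]))
  refine (h.mul_right q⁻¹).congr fun n => ?_
  rw [pow_succ q]
  push_cast
  field_simp

/-- The generating function of a solution of a convolution equation. -/
theorem hasSum_of_conv_eq {M : ℕ} {g x c : ℕ → ℂ} {X : ℂ} (hg : ∀ i, M ≤ i → g i = 0)
    (hc : ∀ i, M ≤ i → c i = 0) (hx : Summable fun n => ‖X ^ n * x n‖)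
    (h : ∀ n, ∑ i ∈ antidiagonal n, g i.1 * x i.2 = c n)
    (hne : ∑ i ∈ range M, X ^ i * g i ≠ 0) :
    HasSum (fun n => X ^ n * x n) ((∑ i ∈ range M, X ^ i * c i) / ∑ i ∈ range M, X ^ i * g i) := by
  have hfin : ∀ f : ℕ → ℂ, (∀ i, M ≤ i → f i = 0) →
      HasSum (fun i => X ^ i * f i) (∑ i ∈ range M, X ^ i * f i) := fun f hf =>
    hasSum_sum_of_ne_finset_zero fun i hi => by rw [hf i (by simpa using hi), mul_zero]
  have h1 := tsum_mul_tsum_eq_tsum_sum_antidiagonal_of_summable_norm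
    (f := fun i => X ^ i * g i) (g := fun n => X ^ n * x n)
    (summable_of_ne_finset_zero (s := range M) fun i hi => by
      rw [hg i (by simpa using hi), mul_zero, norm_zero]) hx
  have h2 : ∀ n, ∑ i ∈ antidiagonal n, X ^ i.1 * g i.1 * (X ^ i.2 * x i.2) = X ^ n * c n := by
    intro n
    rw [← h, Finset.mul_sum]
    refine Finset.sum_congr rfl fun i hi => ?_
    rw [← Finset.HasAntidiagonal.mem_antidiagonal.1 hi, pow_add]
    ring
  simp only [h2] at h1
  rw [(hfin g hg).tsum_eq, (hfin c hc).tsum_eq] at h1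
  rw [← h1, mul_div_cancel_left₀ _ hne]
  exact hx.of_norm.hasSum

end Growth

/-! ### Summation of the symbols for `|z| > 1` -/

section Laurent

variable {m s : ℕ} {r p : Fin (m + 1) → ℕ} {a : Coefs m s}

theorem sum_range_inv_pow_mul_revCoef {z : ℂ} (hz : z ≠ 0) (ℓ : Idx m) :
    ∑ i ∈ range (s + 2), z⁻¹ ^ i * revCoef a i ℓ = (z ^ (s + 1))⁻¹ * resolventCoef a z ℓ := by
  rw [← Fin.sum_univ_eq_sum_range (fun i => z⁻¹ ^ i * revCoef a i ℓ), resolventCoef,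
    Finset.mul_sum, ← Equiv.sum_comp Fin.revPerm]
  refine Finset.sum_congr rfl fun σ _ => ?_
  have h1 := σ.2
  have h2 : ((Fin.revPerm σ : Fin (s + 2)) : ℕ) = s + 1 - σ := by
    rw [Fin.revPerm_apply, Fin.val_rev]; omega
  rw [h2, revCoef_sub, ← mul_assoc]
  congr 1
  have h3 : z ^ (s + 1) = z ^ (s + 1 - (σ : ℕ)) * z ^ (σ : ℕ) := by
    rw [← pow_add]
    congr 1
    omega
  rw [h3, inv_pow]
  field_simp

theorem sum_range_inv_pow_mul_convSymbol {z : ℂ} (hz : z ≠ 0) (θ : Fin (m + 1) → ℝ) :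
    ∑ i ∈ range (s + 2), z⁻¹ ^ i * convSymbol r p (revCoef a i) θ =
      (z ^ (s + 1))⁻¹ * convSymbol r p (resolventCoef a z) θ := by
  simp only [convSymbol, Finset.mul_sum, ← mul_assoc]
  rw [Finset.sum_comm]
  refine Finset.sum_congr rfl fun ℓ _ => ?_
  rw [← Finset.sum_mul, sum_range_inv_pow_mul_revCoef hz]

theorem sum_range_inv_pow_mul_bdrySymbol {z : ℂ} (hz : z ≠ 0) (b : ℕ) (θ : Fin (m + 1) → ℝ) :
    ∑ i ∈ range (s + 2), z⁻¹ ^ i * bdrySymbol r p (revCoef a i) b θ =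
      (z ^ (s + 1))⁻¹ * bdrySymbol r p (resolventCoef a z) b θ := by
  simp only [bdrySymbol, Finset.mul_sum, mul_ite, mul_zero, ← mul_assoc]
  rw [Finset.sum_comm]
  refine Finset.sum_congr rfl fun ℓ _ => ?_
  split_ifs
  · rw [← Finset.sum_mul, sum_range_inv_pow_mul_revCoef hz]
  · simp

theorem norm_bdrySymbol_le (c : Idx m → ℂ) (b : ℕ) (θ : Fin (m + 1) → ℝ) :
    ‖bdrySymbol r p c b θ‖ ≤ ∑ ℓ ∈ stencil r p, ‖c ℓ‖ := by
  refine (norm_sum_le _ _).trans (Finset.sum_le_sum fun ℓ _ => ?_)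
  split_ifs
  · rw [norm_mul, norm_latticeChar, mul_one]
  · simp

theorem convSymbol_revCoef_eq_zero {i : ℕ} (hi : s + 2 ≤ i) (θ : Fin (m + 1) → ℝ) :
    convSymbol r p (revCoef a i) θ = 0 := by
  simp [convSymbol, revCoef_eq_zero a (show s + 1 < i by omega)]

theorem bdrySymbol_revCoef_eq_zero {i : ℕ} (hi : s + 2 ≤ i) (b : ℕ) (θ : Fin (m + 1) → ℝ) :
    bdrySymbol r p (revCoef a i) b θ = 0 := by
  simp [bdrySymbol, revCoef_eq_zero a (show s + 1 < i by omega)]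

/-- With `X = 1/z` the sum is `z^{-(s+1)}` times the symbol of `L(z)`, covered by the von Neumann
condition; at `X = 0` it is the symbol of `Q_{s+1}`. -/
theorem Solvable.sum_convSymbol_revCoef_ne_zero (h : Solvable r p a) (hs : StableScheme r p a)
    {X : ℂ} (hX : ‖X‖ < 1) (θ : Fin (m + 1) → ℝ) :
    ∑ i ∈ range (s + 2), X ^ i * convSymbol r p (revCoef a i) θ ≠ 0 := by
  rcases eq_or_ne X 0 with rfl | hX0
  · rw [Finset.sum_eq_single 0 (fun i _ hi => by simp [hi]) (by simp)]
    simpa using h.convSymbol_revCoef_zero_ne_zero θ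
  · have hz : X⁻¹ ≠ 0 := inv_ne_zero hX0
    have h1 := sum_range_inv_pow_mul_convSymbol (r := r) (p := p) (a := a) hz θ
    rw [inv_inv] at h1
    rw [h1]
    refine mul_ne_zero (inv_ne_zero (pow_ne_zero _ hz))
      (h.convSymbol_resolventCoef_ne_zero hs ?_ θ)
    rw [norm_inv]
    exact (one_lt_inv₀ (norm_pos_iff.2 hX0)).2 hX

/-- The symbols of the response operators grow at most polynomially in time. -/
theorem Solvable.norm_responseSymbol_le (h : Solvable r p a) (hs : StableScheme r p a) (n b : ℕ)
    (θ : Fin (m + 1) → ℝ) :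
    ‖responseSymbol r p a n b θ‖ ≤ (∑ i ∈ range (s + 2), ∑ ℓ ∈ stencil r p, ‖revCoef a i ℓ‖) /
      ‖convSymbol r p (revCoef a 0) θ‖ * ((n : ℝ) + 1) ^ (s + 1) := by
  set g : Polynomial ℂ := ∑ i ∈ range (s + 2),
    Polynomial.C (convSymbol r p (revCoef a i) θ) * Polynomial.X ^ i with hg
  have hcoeff : ∀ i, g.coeff i = convSymbol r p (revCoef a i) θ := by
    intro i
    simp only [hg, Polynomial.finsetSum_coeff, Polynomial.coeff_C_mul_X_pow]
    rw [Finset.sum_ite_eq (range (s + 2)) i fun i => convSymbol r p (revCoef a i) θ]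
    split_ifs with hi
    · rfl
    · exact (convSymbol_revCoef_eq_zero (by simpa using hi) θ).symm
  have hdeg : g.natDegree ≤ s + 1 := by
    rw [Polynomial.natDegree_le_iff_coeff_eq_zero]
    intro i hi
    rw [hcoeff]
    exact convSymbol_revCoef_eq_zero (by omega) θ
  have h1 := norm_le_of_conv_le g (fun X hX => by
      simp only [hg, Polynomial.eval_finsetSum, Polynomial.eval_mul, Polynomial.eval_C,
        Polynomial.eval_pow, Polynomial.eval_X]
      simpa only [mul_comm] using h.sum_convSymbol_revCoef_ne_zero hs hX θ)
    (x := fun n => responseSymbol r p a n b θ)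
    (A := ∑ i ∈ range (s + 2), ∑ ℓ ∈ stencil r p, ‖revCoef a i ℓ‖) (fun n => by
      simp only [hcoeff]
      rw [h.responseSymbol_spec]
      rcases le_or_gt (s + 2) n with hn | hn
      · rw [bdrySymbol_revCoef_eq_zero hn, norm_zero]
        positivity
      · exact (norm_bdrySymbol_le _ _ _).trans (Finset.single_le_sum
          (f := fun i => ∑ ℓ ∈ stencil r p, ‖revCoef a i ℓ‖) (fun i _ => by positivity)
          (Finset.mem_range.2 hn))) n
  rw [hcoeff] at h1
  refine h1.trans ?_
  gcongr
  linarith [Nat.cast_nonneg (α := ℝ) n]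

theorem Solvable.hasSum_responseSymbol (h : Solvable r p a) (hs : StableScheme r p a) {z : ℂ}
    (hz : 1 < ‖z‖) (b : ℕ) (θ : Fin (m + 1) → ℝ) :
    HasSum (fun n => (z ^ n)⁻¹ * responseSymbol r p a n b θ)
      (bdrySymbol r p (resolventCoef a z) b θ / convSymbol r p (resolventCoef a z) θ) := by
  have hz0 : z ≠ 0 := norm_pos_iff.1 (one_pos.trans hz)
  have hX : ‖z⁻¹‖ < 1 := by
    rw [norm_inv]
    exact inv_lt_one_of_one_lt₀ hz
  have h1 := hasSum_of_conv_eq (M := s + 2) (g := fun i => convSymbol r p (revCoef a i) θ)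
    (c := fun i => bdrySymbol r p (revCoef a i) b θ) (x := fun n => responseSymbol r p a n b θ)
    (X := z⁻¹) (fun i hi => convSymbol_revCoef_eq_zero hi θ)
    (fun i hi => bdrySymbol_revCoef_eq_zero hi b θ)
    (Summable.of_nonneg_of_le (fun _ => norm_nonneg _) (fun n => by
        rw [norm_mul, norm_pow]
        exact (mul_le_mul_of_nonneg_left (h.norm_responseSymbol_le hs n b θ) (by positivity)).trans
          (le_of_eq (by ring)))
      ((summable_succ_pow_mul_geometric (s + 1) (norm_nonneg _) hX).mul_left
        ((∑ i ∈ range (s + 2), ∑ ℓ ∈ stencil r p, ‖revCoef a i ℓ‖) /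
          ‖convSymbol r p (revCoef a 0) θ‖)))
    (fun n => h.responseSymbol_spec n b θ) (h.sum_convSymbol_revCoef_ne_zero hs hX θ)
  rw [sum_range_inv_pow_mul_convSymbol hz0, sum_range_inv_pow_mul_bdrySymbol hz0,
    mul_div_mul_left _ _ (inv_ne_zero (pow_ne_zero _ hz0))] at h1
  simpa only [inv_pow] using h1

variable (r p a) in
/-- The generating function of the symbols of the operators `Π_n`. -/
def resolventProj (z : ℂ) (η : Fin m → ℝ) : Matrix (Fin (p 0 + r 0)) (Fin (p 0 + r 0)) ℂ :=
  Matrix.of fun i b => (2 * (Real.pi : ℂ))⁻¹ * ∫ ξ, Complex.exp (Complex.I *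
    ((((p 0 : ℤ) - 1 - (i : ℕ) : ℤ) : ℂ) * (ξ : ℂ))) *
      (bdrySymbol r p (resolventCoef a z) b (Fin.cons ξ η) /
        convSymbol r p (resolventCoef a z) (Fin.cons ξ η)) ∂segMeasure

theorem norm_exp_I_mul_int_mul (n : ℤ) (ξ : ℝ) :
    ‖Complex.exp (Complex.I * ((n : ℂ) * (ξ : ℂ)))‖ = 1 := by
  have : Complex.I * ((n : ℂ) * (ξ : ℂ)) = ((n * ξ : ℝ) : ℂ) * Complex.I := by
    push_cast; ring
  rw [this, Complex.norm_exp_ofReal_mul_I]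

/-- Dominated convergence in the normal frequency: the symbol of `Q_{s+1}` is bounded away from zero
on the compact segment, so the polynomial bound on the coefficients is uniform in `ξ`. -/
theorem Solvable.hasSum_projSymbol (h : Solvable r p a) (hs : StableScheme r p a) {z : ℂ}
    (hz : 1 < ‖z‖) (η : Fin m → ℝ) :
    HasSum (fun n : ℕ => (z ^ n)⁻¹ • projSymbol r p a n η) (resolventProj r p a z η) := by
  refine Pi.hasSum.2 fun i => Pi.hasSum.2 fun b => ?_
  simp only [Matrix.smul_apply, projSymbol, resolventProj, Matrix.of_apply, smul_eq_mul]
  simp only [mul_left_comm _ (2 * (Real.pi : ℂ))⁻¹]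
  refine HasSum.mul_left _ ?_
  simp only [← integral_const_mul]
  have hcons : Continuous fun ξ : ℝ => (Fin.cons ξ η : Fin (m + 1) → ℝ) :=
    Continuous.finCons (A := fun _ => ℝ) continuous_id continuous_const
  obtain ⟨δ, hδ, hδle⟩ : ∃ δ : ℝ, 0 < δ ∧ ∀ ξ ∈ Set.Icc (-Real.pi) Real.pi,
      δ ≤ ‖convSymbol r p (revCoef a 0) (Fin.cons ξ η)‖ := by
    obtain ⟨ξ₀, _, hmin⟩ := (isCompact_Icc (a := -Real.pi) (b := Real.pi)).exists_isMinOn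
      ⟨0, by simp [Real.pi_pos.le]⟩
      (f := fun ξ : ℝ => ‖convSymbol r p (revCoef a 0) (Fin.cons ξ η)‖)
      (((continuous_convSymbol r p _).comp hcons).norm.continuousOn)
    exact ⟨_, norm_pos_iff.2 (h.convSymbol_revCoef_zero_ne_zero _), fun ξ hξ => hmin hξ⟩
  set A : ℝ := ∑ i ∈ range (s + 2), ∑ ℓ ∈ stencil r p, ‖revCoef a i ℓ‖
  have hz1 : ‖z‖⁻¹ < 1 := inv_lt_one_of_one_lt₀ hz
  have hcont : ∀ n, Continuous fun ξ : ℝ => (z ^ n)⁻¹ * (Complex.exp (Complex.I *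
      ((((p 0 : ℤ) - 1 - (i : ℕ) : ℤ) : ℂ) * (ξ : ℂ))) *
        responseSymbol r p a n b (Fin.cons ξ η)) := by
    intro n
    have h1 := (h.continuous_responseSymbol n b).comp hcons
    simp only [Function.comp_def] at h1
    fun_prop
  have hbound : ∀ n, ∀ᵐ ξ : ℝ ∂segMeasure, ‖(z ^ n)⁻¹ * (Complex.exp (Complex.I *
      ((((p 0 : ℤ) - 1 - (i : ℕ) : ℤ) : ℂ) * (ξ : ℂ))) *
        responseSymbol r p a n b (Fin.cons ξ η))‖ ≤ A / δ * (((n : ℝ) + 1) ^ (s + 1) *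
          ‖z‖⁻¹ ^ n) := by
    intro n
    filter_upwards [ae_restrict_mem measurableSet_Icc] with ξ hξ
    rw [norm_mul, norm_mul, norm_exp_I_mul_int_mul, one_mul, norm_inv, norm_pow, ← inv_pow,
      mul_comm, ← mul_assoc]
    gcongr
    refine (h.norm_responseSymbol_le hs n b _).trans ?_
    gcongr
    exact hδle ξ hξ
  refine hasSum_integral_of_dominated_convergence
    (fun n _ => A / δ * (((n : ℝ) + 1) ^ (s + 1) * ‖z‖⁻¹ ^ n))
    (fun n => (hcont n).aestronglyMeasurable) hbound ?_ ?_ ?_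
  · exact .of_forall fun _ =>
      (summable_succ_pow_mul_geometric (s + 1) (by positivity) hz1).mul_left _
  · exact integrable_const _
  · refine .of_forall fun ξ => ?_
    simp only [mul_left_comm _ (Complex.exp _)]
    exact (h.hasSum_responseSymbol hs hz b _).mul_left _

end Laurent

/-! ### The boundary projector of a scalar recurrence -/

section Scalar

/-- `e^{i n ξ}`. -/
def intChar (n : ℤ) (ξ : ℝ) : ℂ := Complex.exp (Complex.I * ((n : ℂ) * (ξ : ℂ)))

theorem intChar_add (k n : ℤ) (ξ : ℝ) : intChar (k + n) ξ = intChar k ξ * intChar n ξ := by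
  rw [intChar, intChar, intChar, ← Complex.exp_add]
  push_cast
  ring_nf

theorem norm_intChar (n : ℤ) (ξ : ℝ) : ‖intChar n ξ‖ = 1 := norm_exp_I_mul_int_mul n ξ

@[fun_prop] theorem continuous_intChar (n : ℤ) : Continuous (intChar n) := by
  unfold intChar
  fun_prop

theorem integral_intChar (n : ℤ) :
    ∫ ξ, intChar n ξ ∂segMeasure = if n = 0 then 2 * (Real.pi : ℂ) else 0 := integral_seg_exp n

/-- Fourier inversion for absolutely summable sequences. -/
theorem integral_intChar_mul_tsum {y : ℤ → ℂ} (hy : Summable fun j => ‖y j‖) (k : ℤ) :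
    (2 * (Real.pi : ℂ))⁻¹ * ∫ ξ, intChar k ξ * ∑' j, intChar (-j) ξ * y j ∂segMeasure = y k := by
  have hpi : (2 * (Real.pi : ℂ)) ≠ 0 := mul_ne_zero two_ne_zero (by exact_mod_cast Real.pi_pos.ne')
  simp only [← tsum_mul_left]
  rw [← integral_tsum_of_summable_integral_norm]
  · have : ∀ j, ∫ ξ, intChar k ξ * (intChar (-j) ξ * y j) ∂segMeasure =
        if j = k then 2 * (Real.pi : ℂ) * y k else 0 := by
      intro j
      simp only [← mul_assoc, ← intChar_add]
      rw [integral_mul_const, integral_intChar]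
      by_cases h : j = k
      · simp [h]
      · rw [if_neg (by omega), if_neg h, zero_mul]
    simp only [this, tsum_ite_eq]
    rw [inv_mul_cancel_left₀ hpi]
  · exact fun j => Continuous.integrable_seg (by fun_prop)
  · simp only [norm_mul, norm_intChar, one_mul, integral_const, smul_eq_mul]
    exact hy.mul_left _

variable (R P : ℕ) (c : ℤ → ℂ)

/-- The symbol of the scalar recurrence `∑ c_ℓ y_{j+ℓ}`. -/
def scalarSymbol (ξ : ℝ) : ℂ := ∑ ℓ ∈ Icc (-(R : ℤ)) P, c ℓ * intChar ℓ ξ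

/-- The scalar analogue of `bdrySymbol`. -/
def scalarBdrySymbol (b : ℕ) (ξ : ℝ) : ℂ :=
  ∑ ℓ ∈ Icc (-(R : ℤ)) P, if (P : ℤ) - 1 - b - ℓ < 0 then
    c ℓ * intChar (ℓ - ((P : ℤ) - 1 - b)) ξ else 0

/-- The matrix of `ω L⁻¹ 1_{j<0} L ι` for the scalar recurrence. -/
def scalarProj : Matrix (Fin (P + R)) (Fin (P + R)) ℂ :=
  Matrix.of fun i b => (2 * (Real.pi : ℂ))⁻¹ * ∫ ξ, intChar ((P : ℤ) - 1 - (i : ℕ)) ξ *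
    (scalarBdrySymbol R P c b ξ / scalarSymbol R P c ξ) ∂segMeasure

/-- Extension by zero of a window. -/
def scalarEmbed (w : Fin (P + R) → ℂ) (t : ℤ) : ℂ :=
  ∑ b : Fin (P + R), if t = (P : ℤ) - 1 - (b : ℕ) then w b else 0

variable {R P c}

theorem scalarEmbed_window (v : ℤ → ℂ) (t : ℤ) :
    scalarEmbed R P (fun b : Fin (P + R) => v ((P : ℤ) - 1 - (b : ℕ))) t =
      if -(R : ℤ) ≤ t ∧ t < P then v t else 0 := by
  rw [scalarEmbed]
  split_ifs with h
  · rw [Finset.sum_eq_single ⟨((P : ℤ) - 1 - t).toNat, by omega⟩]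
    · have h0 : t = (P : ℤ) - 1 - (((P : ℤ) - 1 - t).toNat : ℕ) := by omega
      rw [if_pos h0]
      simp only
      rw [← h0]
    · intro i _ hi
      rw [if_neg]
      intro h0
      exact hi (Fin.ext (by simp; omega))
    · simp
  · refine Finset.sum_eq_zero fun i _ => ?_
    rw [if_neg]
    have := i.2
    omega

theorem continuous_scalarSymbol : Continuous (scalarSymbol R P c) := by
  unfold scalarSymbol
  fun_prop

theorem continuous_scalarBdrySymbol (b : ℕ) : Continuous (scalarBdrySymbol R P c b) := by
  unfold scalarBdrySymbol
  refine continuous_finsetSum _ fun ℓ _ => ?_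
  split_ifs <;> fun_prop

/-- The matrix `scalarProj` solves the boundary problem for the scalar recurrence. -/
theorem scalarProj_mulVec_eq (hc : ∀ ξ, scalarSymbol R P c ξ ≠ 0) {y : ℤ → ℂ}
    (hy : Summable fun j => ‖y j‖) {w : Fin (P + R) → ℂ}
    (h : ∀ j, ∑ ℓ ∈ Icc (-(R : ℤ)) P, c ℓ * y (j + ℓ) =
      if j < 0 then ∑ ℓ ∈ Icc (-(R : ℤ)) P, c ℓ * scalarEmbed R P w (j + ℓ) else 0)
    (i : Fin (P + R)) : (scalarProj R P c *ᵥ w) i = y ((P : ℤ) - 1 - (i : ℕ)) := by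
  have hsum : ∀ ξ, Summable fun j => intChar (-j) ξ * y j := fun ξ =>
    Summable.of_norm (by simpa only [norm_mul, norm_intChar, one_mul] using hy)
  -- Multiply the equation at `j` by `e^{-ijξ}` and sum over `j`: one side is the symbol times the
  -- transform of `y`, the other the finite boundary sum.
  have key : ∀ ξ, ∑ b : Fin (P + R), scalarBdrySymbol R P c b ξ / scalarSymbol R P c ξ * w b =
      ∑' j, intChar (-j) ξ * y j := by
    intro ξ
    have h1 : HasSum (fun j => intChar (-j) ξ * ∑ ℓ ∈ Icc (-(R : ℤ)) P, c ℓ * y (j + ℓ))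
        (scalarSymbol R P c ξ * ∑' j, intChar (-j) ξ * y j) := by
      rw [scalarSymbol, Finset.sum_mul]
      simp only [Finset.mul_sum]
      refine hasSum_sum fun ℓ _ => ?_
      have h2 := ((Equiv.addRight ℓ).hasSum_iff.2 (hsum ξ).hasSum).mul_left (c ℓ * intChar ℓ ξ)
      have h3 : (fun j => intChar (-j) ξ * (c ℓ * y (j + ℓ))) = fun j =>
          c ℓ * intChar ℓ ξ * (intChar (-(j + ℓ)) ξ * y (j + ℓ)) := by
        ext j
        rw [show -j = ℓ + -(j + ℓ) by ring, intChar_add]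
        ring
      rw [h3]
      exact h2
    have h3 : HasSum (fun j => intChar (-j) ξ * ∑ ℓ ∈ Icc (-(R : ℤ)) P, c ℓ * y (j + ℓ))
        (∑ b : Fin (P + R), scalarBdrySymbol R P c b ξ * w b) := by
      have h4 : ∀ j, intChar (-j) ξ * ∑ ℓ ∈ Icc (-(R : ℤ)) P, c ℓ * y (j + ℓ) =
          ∑ b : Fin (P + R), ∑ ℓ ∈ Icc (-(R : ℤ)) P, if j = (P : ℤ) - 1 - (b : ℕ) - ℓ then
            (if (P : ℤ) - 1 - (b : ℕ) - ℓ < 0 then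
              c ℓ * intChar (ℓ - ((P : ℤ) - 1 - (b : ℕ))) ξ else 0) * w b else 0 := by
        intro j
        rw [h, Finset.sum_comm]
        by_cases hj : j < 0
        · rw [if_pos hj, Finset.mul_sum]
          refine Finset.sum_congr rfl fun ℓ _ => ?_
          rw [scalarEmbed, Finset.mul_sum, Finset.mul_sum]
          refine Finset.sum_congr rfl fun b _ => ?_
          by_cases h5 : j = (P : ℤ) - 1 - (b : ℕ) - ℓ
          · rw [if_pos (by omega), if_pos h5, if_pos (by omega),
              show -j = ℓ - ((P : ℤ) - 1 - (b : ℕ)) by omega]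
            ring
          · rw [if_neg (by omega), if_neg h5, mul_zero, mul_zero]
        · rw [if_neg hj, mul_zero, eq_comm]
          refine Finset.sum_eq_zero fun ℓ _ => Finset.sum_eq_zero fun b _ => ?_
          by_cases h5 : j = (P : ℤ) - 1 - (b : ℕ) - ℓ
          · rw [if_pos h5, if_neg (by omega), zero_mul]
          · rw [if_neg h5]
      simp only [h4, scalarBdrySymbol, Finset.sum_mul]
      exact hasSum_sum fun b _ => hasSum_sum fun ℓ _ => hasSum_ite_eq _ _
    have h5 := h3.unique h1
    rw [← mul_right_inj' (hc ξ), ← h5, Finset.mul_sum]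
    refine Finset.sum_congr rfl fun b _ => ?_
    have := hc ξ
    field_simp
  rw [← integral_intChar_mul_tsum hy]
  simp only [← key, Matrix.mulVec, dotProduct, scalarProj, Matrix.of_apply, Finset.mul_sum]
  rw [integral_finsetSum _ fun b _ => ?_, Finset.mul_sum]
  · refine Finset.sum_congr rfl fun b _ => ?_
    rw [mul_assoc, ← integral_mul_const]
    simp only [mul_assoc]
  · have h1 := continuous_scalarBdrySymbol (R := R) (P := P) (c := c) b
    have h2 := (continuous_scalarSymbol (R := R) (P := P) (c := c)).inv₀ hc
    refine Continuous.integrable_seg ?_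
    simp only [div_eq_mul_inv]
    exact (continuous_intChar _).mul ((h1.mul h2).mul continuous_const)

/-- Windows of decaying solutions on the right half line are fixed. -/
theorem scalarProj_mulVec_of_right (hc : ∀ ξ, scalarSymbol R P c ξ ≠ 0) {v : ℤ → ℂ}
    (hv : Summable fun j => ‖v j‖) (hsupp : ∀ j < -(R : ℤ), v j = 0)
    (h : ∀ j, 0 ≤ j → ∑ ℓ ∈ Icc (-(R : ℤ)) P, c ℓ * v (j + ℓ) = 0) :
    scalarProj R P c *ᵥ (fun b : Fin (P + R) => v ((P : ℤ) - 1 - (b : ℕ))) =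
      fun b : Fin (P + R) => v ((P : ℤ) - 1 - (b : ℕ)) := by
  ext i
  refine scalarProj_mulVec_eq hc hv (fun j => ?_) i
  split_ifs with hj
  -- Rows `j + ℓ` with `j < 0` lie below `P`; there `v` is its own window, since it vanishes below
  -- `-R`.
  · refine Finset.sum_congr rfl fun ℓ hℓ => ?_
    rw [Finset.mem_Icc] at hℓ
    rw [scalarEmbed_window]
    split_ifs with h1
    · rfl
    · rw [hsupp _ (by omega)]
  · exact h j (by omega)

/-- Windows of decaying solutions on the left half line are annihilated. -/
theorem scalarProj_mulVec_of_left (hc : ∀ ξ, scalarSymbol R P c ξ ≠ 0) {v : ℤ → ℂ}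
    (hv : Summable fun j => ‖v j‖) (hsupp : ∀ j, (P : ℤ) ≤ j → v j = 0)
    (h : ∀ j < 0, ∑ ℓ ∈ Icc (-(R : ℤ)) P, c ℓ * v (j + ℓ) = 0) :
    scalarProj R P c *ᵥ (fun b : Fin (P + R) => v ((P : ℤ) - 1 - (b : ℕ))) = 0 := by
  ext i
  -- The left truncation again: `-v` below the boundary rows solves the boundary problem and has
  -- zero window.
  rw [scalarProj_mulVec_eq hc (y := fun j => if j < -(R : ℤ) then -v j else 0) ?_ (fun j => ?_) i]
  · have := i.2
    rw [if_neg (by omega)]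
    rfl
  · refine Summable.of_nonneg_of_le (fun _ => norm_nonneg _) (fun j => ?_) hv
    split_ifs <;> simp
  · split_ifs with hj
    · refine eq_of_sub_eq_zero ?_
      rw [← Finset.sum_sub_distrib]
      refine (Finset.sum_congr rfl (g := fun ℓ => -(c ℓ * v (j + ℓ))) fun ℓ _ => ?_).trans
        (by rw [Finset.sum_neg_distrib, h j hj, neg_zero])
      rw [scalarEmbed_window]
      by_cases h1 : j + ℓ < -(R : ℤ)
      · rw [if_pos h1, if_neg (by omega)]
        ring
      · rw [if_neg h1]
        by_cases h2 : j + ℓ < P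
        · rw [if_pos (by omega)]
          ring
        · rw [if_neg (by omega), hsupp _ (by omega)]
          ring
    · refine Finset.sum_eq_zero fun ℓ hℓ => ?_
      rw [Finset.mem_Icc] at hℓ
      rw [if_neg (by omega), mul_zero]

end Scalar

/-! ### Summable orbits of generalized eigenvectors -/

section Orbits

variable {V : Type*} [NormedAddCommGroup V] [NormedSpace ℂ V]

/-- Summing the inequalities gives `(1 - q) ∑ x ≤ x 0 + ∑ y` for every partial sum of `x`. -/
theorem summable_of_succ_le {x y : ℕ → ℝ} {q : ℝ} (hx : ∀ n, 0 ≤ x n) (hy0 : ∀ n, 0 ≤ y n)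
    (hq : q < 1) (hy : Summable y) (h : ∀ n, x (n + 1) ≤ q * x n + y n) :
    Summable x := by
  have hB : ∀ n, ∑ i ∈ range n, y i ≤ ∑' i, y i := fun n => hy.sum_le_tsum _ fun i _ => hy0 i
  have hB0 : 0 ≤ ∑' i, y i := tsum_nonneg hy0
  refine summable_of_sum_range_le (c := (x 0 + ∑' i, y i) / (1 - q)) hx fun n => ?_
  have h1q : 0 < 1 - q := by linarith
  rw [le_div_iff₀ h1q]
  have h1 : ∑ i ∈ range (n + 1), x i ≤ x 0 + (q * ∑ i ∈ range n, x i + ∑ i ∈ range n, y i) := by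
    rw [Finset.sum_range_succ', Finset.mul_sum, ← Finset.sum_add_distrib, add_comm (x 0)]
    gcongr with i _
    exact h i
  have h2 : ∑ i ∈ range n, x i ≤ ∑ i ∈ range (n + 1), x i := by
    rw [Finset.sum_range_succ]
    linarith [hx n]
  have := hB n
  nlinarith

/-- The vector `y = (f - μ) x` has a smaller exponent, and `f^(n+1) x = μ f^n x + f^n y` is a
contraction with summable forcing. -/
theorem summable_norm_pow_apply_of_genEigenspace (f : Module.End ℂ V) {μ : ℂ} (hμ : ‖μ‖ < 1) (k : ℕ)
    {x : V} (hx : ((f - μ • (1 : Module.End ℂ V)) ^ k) x = 0) : Summable fun n => ‖(f ^ n) x‖ := by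
  induction k generalizing x with
  | zero =>
    have : x = 0 := by simpa using hx
    simp [this]
  | succ k ih =>
    set y := (f - μ • (1 : Module.End ℂ V)) x with hy
    have h1 : Summable fun n => ‖(f ^ n) y‖ := ih (by rw [hy, ← Module.End.mul_apply, ← pow_succ, hx])
    refine summable_of_succ_le (fun _ => norm_nonneg _) (fun _ => norm_nonneg _) hμ
      h1 fun n => ?_
    have h2 : (f ^ (n + 1)) x = μ • (f ^ n) x + (f ^ n) y := by
      rw [hy, pow_succ, Module.End.mul_apply, LinearMap.sub_apply, map_sub,
        LinearMap.smul_apply, Module.End.one_apply, map_smul]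
      abel
    rw [h2]
    exact (norm_add_le _ _).trans (by rw [norm_smul])

/-- With `Y` the backward orbit of `(f - μ) x`, impose `(f - μ) X_n = Y_n`. Then `f X_{n+1} = X_n`
forces `X_{n+1} = μ⁻¹ (X_n - Y_{n+1})`, a contraction with summable forcing. Invertibility of `f` is
not required. -/
theorem exists_backward_orbit_of_genEigenspace (f : Module.End ℂ V) {μ : ℂ} (hμ : 1 < ‖μ‖) (k : ℕ)
    {x : V} (hx : ((f - μ • (1 : Module.End ℂ V)) ^ k) x = 0) :
    ∃ X : ℕ → V, X 0 = x ∧ (∀ n, f (X (n + 1)) = X n) ∧ Summable fun n => ‖X n‖ := by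
  induction k generalizing x with
  | zero =>
    have : x = 0 := by simpa using hx
    exact ⟨0, by simp [this], by simp, by simp⟩
  | succ k ih =>
    have hμ0 : μ ≠ 0 := norm_pos_iff.1 (one_pos.trans hμ)
    obtain ⟨Y, hY0, hY, hYs⟩ := ih (x := (f - μ • (1 : Module.End ℂ V)) x)
      (by rw [← Module.End.mul_apply, ← pow_succ, hx])
    set X : ℕ → V := fun n => Nat.rec x (fun n X => μ⁻¹ • (X - Y (n + 1))) n with hX
    have hX1 : ∀ n, X (n + 1) = μ⁻¹ • (X n - Y (n + 1)) := fun n => rfl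
    have hinv : ∀ n, f (X n) = μ • X n + Y n := by
      intro n
      induction n with
      | zero =>
        rw [hY0, LinearMap.sub_apply, LinearMap.smul_apply, Module.End.one_apply]
        simp [hX]
      | succ n ih =>
        rw [hX1, map_smul, map_sub, ih, hY, smul_smul, mul_inv_cancel₀ hμ0, one_smul,
          add_sub_cancel_right, smul_smul, inv_mul_cancel₀ hμ0, one_smul]
        abel
    refine ⟨X, rfl, fun n => ?_, ?_⟩
    · refine (hinv (n + 1)).trans ?_
      rw [hX1, smul_smul, mul_inv_cancel₀ hμ0, one_smul, sub_add_cancel]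
    · refine summable_of_succ_le (y := fun n => ‖μ‖⁻¹ * ‖Y (n + 1)‖) (q := ‖μ‖⁻¹)
        (fun _ => norm_nonneg _) (fun _ => by positivity)
        (inv_lt_one_of_one_lt₀ hμ) (((summable_nat_add_iff 1).2 hYs).mul_left _) fun n => ?_
      rw [hX1, norm_smul, norm_inv, ← mul_add]
      gcongr
      exact norm_sub_le _ _

end Orbits

/-! ### Reduction to the scalar recurrence at fixed `(z, η)` -/

section Reduction

variable {m s : ℕ} {r p : Fin (m + 1) → ℕ} {a : Coefs m s}

theorem sum_stencil_eq {M : Type*} [AddCommMonoid M] (f : Idx m → M) :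
    ∑ ℓ ∈ stencil r p, f ℓ = ∑ ℓ₁ ∈ Icc (-(r 0 : ℤ)) (p 0), ∑ ℓ' ∈ stencil (Fin.tail r) (Fin.tail p),
      f (Fin.cons ℓ₁ ℓ') := by
  rw [← Finset.sum_product']
  refine Finset.sum_nbij' (fun ℓ => (ℓ 0, Fin.tail ℓ)) (fun x => Fin.cons x.1 x.2) ?_ ?_ ?_ ?_ ?_
  · intro ℓ hℓ
    simp only [stencil, Finset.mem_Icc, Pi.le_def, Finset.mem_product] at hℓ ⊢
    exact ⟨⟨hℓ.1 0, hℓ.2 0⟩, fun i => hℓ.1 i.succ, fun i => hℓ.2 i.succ⟩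
  · rintro ⟨ℓ₁, ℓ'⟩ hℓ
    simp only [stencil, Finset.mem_Icc, Pi.le_def, Finset.mem_product] at hℓ ⊢
    exact ⟨Fin.cases hℓ.1.1 hℓ.2.1, Fin.cases hℓ.1.2 hℓ.2.2⟩
  · intro ℓ _
    exact Fin.cons_self_tail ℓ
  · rintro ⟨ℓ₁, ℓ'⟩ _
    simp
  · intro ℓ _
    simp only [Fin.cons_self_tail]

theorem normalCoef_eq (ℓ₁ : ℤ) (z : ℂ) (η : Fin m → ℝ) :
    normalCoef r p a ℓ₁ z η = ∑ ℓ' ∈ stencil (Fin.tail r) (Fin.tail p),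
      resolventCoef a z (Fin.cons ℓ₁ ℓ') * latticeChar ℓ' η := by
  simp only [normalCoef, tangCoef, resolventCoef, latticeChar, Finset.sum_mul, Finset.mul_sum]
  rw [Finset.sum_comm]
  simp only [mul_assoc]

theorem convSymbol_resolventCoef_eq (z : ℂ) (ξ : ℝ) (η : Fin m → ℝ) :
    convSymbol r p (resolventCoef a z) (Fin.cons ξ η) =
      scalarSymbol (r 0) (p 0) (fun ℓ => normalCoef r p a ℓ z η) ξ := by
  rw [convSymbol, sum_stencil_eq, scalarSymbol]
  refine Finset.sum_congr rfl fun ℓ₁ _ => ?_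
  rw [normalCoef_eq, Finset.sum_mul]
  refine Finset.sum_congr rfl fun ℓ' _ => ?_
  rw [latticeChar_cons, Fin.tail_cons, Fin.cons_zero, intChar]
  ring

theorem bdrySymbol_resolventCoef_eq (z : ℂ) (b : ℕ) (ξ : ℝ) (η : Fin m → ℝ) :
    bdrySymbol r p (resolventCoef a z) b (Fin.cons ξ η) =
      scalarBdrySymbol (r 0) (p 0) (fun ℓ => normalCoef r p a ℓ z η) b ξ := by
  rw [bdrySymbol, sum_stencil_eq, scalarBdrySymbol]
  refine Finset.sum_congr rfl fun ℓ₁ _ => ?_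
  simp only [Pi.sub_apply, bdrySite, Fin.cons_zero]
  split_ifs
  · rw [normalCoef_eq, Finset.sum_mul]
    refine Finset.sum_congr rfl fun ℓ' _ => ?_
    have h1 : Fin.tail ((Fin.cons ℓ₁ ℓ' : Idx m) - Fin.cons ((p 0 : ℤ) - 1 - b) 0) = ℓ' := by
      ext l
      simp [Fin.tail]
    rw [latticeChar_cons, h1, intChar, Pi.sub_apply, Fin.cons_zero, Fin.cons_zero]
    ring
  · simp

theorem resolventProj_eq (z : ℂ) (η : Fin m → ℝ) :
    resolventProj r p a z η = scalarProj (r 0) (p 0) (fun ℓ => normalCoef r p a ℓ z η) := by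
  ext i b
  simp only [resolventProj, scalarProj, Matrix.of_apply, convSymbol_resolventCoef_eq,
    bdrySymbol_resolventCoef_eq, intChar]

end Reduction

/-! ### Stable and unstable subspaces of the companion matrix -/

section Companion

variable {m s : ℕ} {r p : Fin (m + 1) → ℕ} {a : Coefs m s} {z : ℂ} {η : Fin m → ℝ}

theorem sum_Icc_eq_add {M : Type*} [AddCommMonoid M] (R P : ℕ) (f : ℤ → M) :
    ∑ ℓ ∈ Icc (-(R : ℤ)) P, f ℓ = f P + ∑ b : Fin (P + R), f ((P : ℤ) - 1 - (b : ℕ)) := by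
  rw [← Finset.sum_erase_add _ _ (show (P : ℤ) ∈ Icc (-(R : ℤ)) P by simp), add_comm]
  congr 1
  rw [Fin.sum_univ_eq_sum_range (fun b => f ((P : ℤ) - 1 - (b : ℕ)))]
  refine Finset.sum_nbij' (fun ℓ => ((P : ℤ) - 1 - ℓ).toNat) (fun b => (P : ℤ) - 1 - (b : ℕ))
    ?_ ?_ ?_ ?_ ?_
  · intro ℓ hℓ
    simp at hℓ ⊢
    omega
  · intro b hb
    simp at hb ⊢
    omega
  · intro ℓ hℓ
    simp at hℓ
    omega
  · intro b hb
    omega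
  · intro ℓ hℓ
    simp at hℓ
    congr 1
    omega

theorem companion_mulVec_succ (x : Fin (p 0 + r 0) → ℂ) {i j : Fin (p 0 + r 0)}
    (h : (i : ℕ) = (j : ℕ) + 1) : (companion r p a z η *ᵥ x) i = x j := by
  rw [Matrix.mulVec, dotProduct, Finset.sum_eq_single j]
  · simp [companion, h]
  · intro k _ hk
    have : ¬ (i : ℕ) = (k : ℕ) + 1 := fun h2 => hk (Fin.ext (by omega))
    simp only [companion, Matrix.of_apply]
    rw [if_neg (by omega), if_neg this, zero_mul]
  · simp

/-- Each application moves entries down one place, so all entries of an orbit are values of a single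
scalar sequence. -/
theorem companion_pow_mulVec (x : Fin (p 0 + r 0) → ℂ) (k : ℕ) {i j : Fin (p 0 + r 0)}
    (h : (i : ℕ) = (j : ℕ) + k) :
    ((Matrix.toLin' (companion r p a z η) ^ k) x) i = x j := by
  induction k generalizing i with
  | zero => rw [show i = j from Fin.ext (by simpa using h)]; rfl
  | succ k ih =>
    have hi : (j : ℕ) + k < p 0 + r 0 := by omega
    rw [pow_succ', Module.End.mul_apply, Matrix.toLin'_apply,
      companion_mulVec_succ _ (j := ⟨(j : ℕ) + k, hi⟩) (by simp; omega)]
    exact ih rfl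

theorem companion_mulVec_zero (hP : normalCoef r p a (p 0 : ℤ) z η ≠ 0)
    (x : Fin (p 0 + r 0) → ℂ) (h0 : 0 < p 0 + r 0) :
    normalCoef r p a (p 0 : ℤ) z η * (companion r p a z η *ᵥ x) ⟨0, h0⟩ +
      ∑ b : Fin (p 0 + r 0), normalCoef r p a ((p 0 : ℤ) - 1 - (b : ℕ)) z η * x b = 0 := by
  rw [Matrix.mulVec, dotProduct, Finset.mul_sum, ← Finset.sum_add_distrib]
  refine Finset.sum_eq_zero fun b _ => ?_
  simp only [companion, Matrix.of_apply, if_true]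
  field_simp
  ring

/-- A sequence whose windows at `t` and `t + 1` are related by the companion matrix satisfies the
recurrence at `t`. -/
theorem recurrence_of_companion (hP : normalCoef r p a (p 0 : ℤ) z η ≠ 0) (h0 : 0 < p 0 + r 0)
    {x : Fin (p 0 + r 0) → ℂ} {v : ℤ → ℂ} {t : ℤ}
    (h : ∀ b : Fin (p 0 + r 0), x b = v (t + ((p 0 : ℤ) - 1 - (b : ℕ))))
    (h1 : (companion r p a z η *ᵥ x) ⟨0, h0⟩ = v (t + p 0)) :
    ∑ ℓ ∈ Icc (-(r 0 : ℤ)) (p 0), normalCoef r p a ℓ z η * v (t + ℓ) = 0 := by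
  rw [sum_Icc_eq_add, ← companion_mulVec_zero hP x h0, h1]
  simp only [h]

theorem summable_int_of_nat {f : ℤ → ℂ} {g : ℕ → ℤ} (hg : Function.Injective g)
    (hf : ∀ j, j ∉ Set.range g → f j = 0) {u : ℕ → ℝ} (hu : Summable u)
    (h : ∀ n, ‖f (g n)‖ ≤ u n) : Summable fun j => ‖f j‖ :=
  (hg.summable_iff fun j hj => by rw [hf j hj, norm_zero]).1
    (Summable.of_nonneg_of_le (fun _ => norm_nonneg _) h hu)

/-- The last entries of the forward orbit, placed on the rows from `-r₁` upwards, form a summable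
sequence whose window shifted by `n` is `f^n x`. It satisfies the recurrence at every `j ≥ 0`. -/
theorem scalarProj_mulVec_of_mem_stable (hP : normalCoef r p a (p 0 : ℤ) z η ≠ 0)
    (hc : ∀ ξ, scalarSymbol (r 0) (p 0) (fun ℓ => normalCoef r p a ℓ z η) ξ ≠ 0)
    {x : Fin (p 0 + r 0) → ℂ}
    (hx : Summable fun n => ‖(Matrix.toLin' (companion r p a z η) ^ n) x‖) :
    scalarProj (r 0) (p 0) (fun ℓ => normalCoef r p a ℓ z η) *ᵥ x = x := by
  rcases Nat.eq_zero_or_pos (p 0 + r 0) with h0 | h0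
  · ext i
    exact absurd i.2 (by omega)
  set f := Matrix.toLin' (companion r p a z η) with hf
  set last : Fin (p 0 + r 0) := ⟨p 0 + r 0 - 1, by omega⟩ with hlast
  set v : ℤ → ℂ := fun j => if -(r 0 : ℤ) ≤ j then (f ^ (j + r 0).toNat) x last else 0 with hv
  have hwin : ∀ (n : ℕ) (b : Fin (p 0 + r 0)),
      (f ^ n) x b = v ((n : ℤ) + ((p 0 : ℤ) - 1 - (b : ℕ))) := by
    intro n b
    have hb := b.2
    have h1 : ((n : ℤ) + ((p 0 : ℤ) - 1 - (b : ℕ)) + r 0).toNat = (p 0 + r 0 - 1 - b) + n := by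
      omega
    rw [hv]
    simp only
    rw [if_pos (by omega), h1, pow_add, Module.End.mul_apply,
      companion_pow_mulVec ((f ^ n) x) _ (i := last) (j := b) (by simp [hlast]; omega)]
  have hx0 : x = fun b : Fin (p 0 + r 0) => v ((p 0 : ℤ) - 1 - (b : ℕ)) := by
    ext b
    simpa using hwin 0 b
  have key := scalarProj_mulVec_of_right hc (v := v) ?_ (fun j hj => if_neg (by omega)) ?_
  · rwa [← hx0] at key
  · refine summable_int_of_nat (g := fun n : ℕ => (n : ℤ) - r 0)
      (fun _ _ h => by simpa using h) (fun j hj => if_neg fun h => hj ⟨(j + r 0).toNat, ?_⟩) hx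
      fun n => ?_
    · simp only
      omega
    · simp only [hv]
      rw [if_pos (by omega), show ((n : ℤ) - r 0 + r 0).toNat = n by omega]
      exact norm_le_pi_norm _ _
  · intro j hj
    obtain ⟨n, rfl⟩ := Int.eq_ofNat_of_zero_le hj
    refine recurrence_of_companion hP h0 (x := (f ^ n) x) (hwin n) ?_
    have h1 := hwin (n + 1) ⟨0, h0⟩
    rw [pow_succ', Module.End.mul_apply, hf, Matrix.toLin'_apply] at h1
    rw [h1]
    congr 1
    push_cast
    ring

/-- Mirror image: the first entries of the backward orbit fill the rows from `p₁ - 1` downwards. The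
step from `X (n + 1)` to `X n` is the recurrence at `-(n + 1)`, so every `j < 0` is covered. -/
theorem scalarProj_mulVec_of_mem_unstable (hP : normalCoef r p a (p 0 : ℤ) z η ≠ 0)
    (hc : ∀ ξ, scalarSymbol (r 0) (p 0) (fun ℓ => normalCoef r p a ℓ z η) ξ ≠ 0)
    {X : ℕ → Fin (p 0 + r 0) → ℂ} (hX : ∀ n, Matrix.toLin' (companion r p a z η) (X (n + 1)) = X n)
    (hs : Summable fun n => ‖X n‖) :
    scalarProj (r 0) (p 0) (fun ℓ => normalCoef r p a ℓ z η) *ᵥ (X 0) = 0 := by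
  rcases Nat.eq_zero_or_pos (p 0 + r 0) with h0 | h0
  · ext i
    exact absurd i.2 (by omega)
  set f := Matrix.toLin' (companion r p a z η) with hf
  have hpow : ∀ k n, (f ^ k) (X (n + k)) = X n := by
    intro k
    induction k with
    | zero => intro n; rfl
    | succ k ih =>
      intro n
      rw [pow_succ, Module.End.mul_apply, ← add_assoc, hX, ih]
  set v : ℤ → ℂ := fun j => if j < (p 0 : ℤ) then X ((p 0 : ℤ) - 1 - j).toNat ⟨0, h0⟩ else 0 with hv
  have hwin : ∀ (n : ℕ) (b : Fin (p 0 + r 0)),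
      X n b = v (-(n : ℤ) + ((p 0 : ℤ) - 1 - (b : ℕ))) := by
    intro n b
    have h1 : ((p 0 : ℤ) - 1 - (-(n : ℤ) + ((p 0 : ℤ) - 1 - (b : ℕ)))).toNat = n + b := by omega
    rw [hv]
    simp only
    rw [if_pos (by omega), h1, ← companion_pow_mulVec (X (n + b)) b (i := b) (j := ⟨0, h0⟩) (by simp),
      ← hf, hpow]
  have hx0 : X 0 = fun b : Fin (p 0 + r 0) => v ((p 0 : ℤ) - 1 - (b : ℕ)) := by
    ext b
    simpa using hwin 0 b
  have key := scalarProj_mulVec_of_left hc (v := v) ?_ (fun j hj => if_neg (by omega)) ?_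
  · rwa [← hx0] at key
  · refine summable_int_of_nat (g := fun n : ℕ => (p 0 : ℤ) - 1 - n)
      (fun _ _ h => by simpa using h) (fun j hj => if_neg fun h => hj ⟨((p 0 : ℤ) - 1 - j).toNat, ?_⟩)
      hs fun n => ?_
    · simp only
      omega
    · simp only [hv]
      rw [if_pos (by omega), show ((p 0 : ℤ) - 1 - ((p 0 : ℤ) - 1 - n)).toNat = n by omega]
      exact norm_le_pi_norm _ _
  · intro j hj
    obtain ⟨n, rfl⟩ : ∃ n : ℕ, j = -((n + 1 : ℕ) : ℤ) := ⟨(-j - 1).toNat, by omega⟩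
    refine recurrence_of_companion hP h0 (x := X (n + 1)) (hwin (n + 1)) ?_
    have h1 := hwin n ⟨0, h0⟩
    rw [← hX n, hf, Matrix.toLin'_apply] at h1
    rw [h1]
    congr 1
    push_cast
    ring

/-- The companion matrix has no eigenvalues on the unit circle. -/
theorem companion_eigenvector_eq_zero (hP : normalCoef r p a (p 0 : ℤ) z η ≠ 0)
    (hc : ∀ ξ, scalarSymbol (r 0) (p 0) (fun ℓ => normalCoef r p a ℓ z η) ξ ≠ 0)
    {κ : ℂ} (hκ : ‖κ‖ = 1) {x : Fin (p 0 + r 0) → ℂ}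
    (hx : Matrix.toLin' (companion r p a z η) x = κ • x) : x = 0 := by
  rcases Nat.eq_zero_or_pos (p 0 + r 0) with h0 | h0
  · ext i
    exact absurd i.2 (by omega)
  set f := Matrix.toLin' (companion r p a z η) with hf
  have hpow : ∀ k : ℕ, (f ^ k) x = κ ^ k • x := by
    intro k
    induction k with
    | zero => simp
    | succ k ih => rw [pow_succ, Module.End.mul_apply, hx, map_smul, ih, smul_smul, pow_succ']
  set last : Fin (p 0 + r 0) := ⟨p 0 + r 0 - 1, by omega⟩ with hlast
  obtain ⟨ξ, hξ⟩ : ∃ ξ : ℝ, κ = Complex.exp (Complex.I * ξ) := by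
    refine ⟨Complex.arg κ, ?_⟩
    have := Complex.norm_mul_exp_arg_mul_I κ
    rw [hκ, Complex.ofReal_one, one_mul, mul_comm] at this
    exact this.symm
  have hchar : ∀ k : ℕ, intChar (k : ℤ) ξ = κ ^ k := by
    intro k
    rw [intChar, hξ, ← Complex.exp_nat_mul]
    push_cast
    ring_nf
  have hb : ∀ b : Fin (p 0 + r 0),
      x b = intChar ((p 0 : ℤ) - 1 - (b : ℕ)) ξ * (intChar (r 0) ξ * x last) := by
    intro b
    have hb' := b.2
    have h1 := companion_pow_mulVec (a := a) (z := z) (η := η) x (p 0 + r 0 - 1 - b) (i := last) (j := b)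
      (by simp [hlast]; omega)
    rw [← hf, hpow, Pi.smul_apply, smul_eq_mul, ← hchar] at h1
    rw [← mul_assoc, ← intChar_add, ← h1]
    congr 2
    omega
  -- The eigenvector is the window of a multiple of `κ^j`. Its recurrence at `0` is the symbol at
  -- `ξ`, times a nonzero character, times the last entry.
  have h2 := recurrence_of_companion hP h0 (x := x) (t := 0)
    (v := fun j => intChar j ξ * (intChar (r 0) ξ * x last)) (fun b => by rw [zero_add]; exact hb b) (by
      have h3 : companion r p a z η *ᵥ x = κ • x := by rw [← Matrix.toLin'_apply]; exact hx
      rw [h3, Pi.smul_apply, hb, smul_eq_mul, ← pow_one κ, ← hchar, ← mul_assoc, ← intChar_add]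
      congr 2
      simp)
  simp only [zero_add, ← mul_assoc] at h2
  rw [← Finset.sum_mul, ← Finset.sum_mul] at h2
  have h3 : intChar (r 0) ξ ≠ 0 := Complex.exp_ne_zero _
  have h4 : x last = 0 := by
    rcases mul_eq_zero.1 h2 with h | h
    · rcases mul_eq_zero.1 h with h | h
      · exact absurd h (hc ξ)
      · exact absurd h h3
    · exact h
  ext b
  rw [hb, h4]
  simp

/-- A vector in both subspaces is fixed and annihilated, hence zero. The generalized eigenspaces
span, and those on the unit circle are trivial. -/
theorem isStableProjector_scalarProj (hP : normalCoef r p a (p 0 : ℤ) z η ≠ 0)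
    (hc : ∀ ξ, scalarSymbol (r 0) (p 0) (fun ℓ => normalCoef r p a ℓ z η) ξ ≠ 0) :
    IsStableProjector (companion r p a z η)
      (scalarProj (r 0) (p 0) (fun ℓ => normalCoef r p a ℓ z η)) := by
  set f := Matrix.toLin' (companion r p a z η) with hf
  set Q := scalarProj (r 0) (p 0) (fun ℓ => normalCoef r p a ℓ z η) with hQ
  have hst : ∀ x ∈ stableSpace (companion r p a z η), Q *ᵥ x = x := by
    have : stableSpace (companion r p a z η) ≤ LinearMap.ker (Matrix.toLin' Q - 1) := by
      refine iSup_le fun μ x hx => ?_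
      obtain ⟨k, hk⟩ := (Module.End.mem_maxGenEigenspace _ _ _).1 hx
      rw [LinearMap.mem_ker, LinearMap.sub_apply, sub_eq_zero, Matrix.toLin'_apply]
      exact scalarProj_mulVec_of_mem_stable hP hc
        (summable_norm_pow_apply_of_genEigenspace _ μ.2 k hk)
    intro x hx
    have h1 := this hx
    rw [LinearMap.mem_ker, LinearMap.sub_apply, sub_eq_zero, Matrix.toLin'_apply] at h1
    exact h1
  have hun : ∀ x ∈ unstableSpace (companion r p a z η), Q *ᵥ x = 0 := by
    have : unstableSpace (companion r p a z η) ≤ LinearMap.ker (Matrix.toLin' Q) := by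
      refine iSup_le fun μ x hx => ?_
      obtain ⟨k, hk⟩ := (Module.End.mem_maxGenEigenspace _ _ _).1 hx
      obtain ⟨X, rfl, hX, hs⟩ := exists_backward_orbit_of_genEigenspace _ μ.2 k hk
      rw [LinearMap.mem_ker, Matrix.toLin'_apply]
      exact scalarProj_mulVec_of_mem_unstable hP hc hX hs
    intro x hx
    have h1 := this hx
    rwa [LinearMap.mem_ker, Matrix.toLin'_apply] at h1
  refine ⟨⟨?_, ?_⟩, hst, hun⟩
  · rw [Submodule.disjoint_def]
    intro x h1 h2
    rw [← hst x h1, hun x h2]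
  · rw [codisjoint_iff_le_sup, ← Module.End.iSup_maxGenEigenspace_eq_top f]
    refine iSup_le fun μ => ?_
    rcases lt_trichotomy ‖μ‖ 1 with h | h | h
    · exact le_sup_of_le_left (le_iSup (fun μ : {μ : ℂ // ‖μ‖ < 1} => Module.End.maxGenEigenspace f μ) ⟨μ, h⟩)
    · intro x hx
      obtain ⟨k, hk⟩ := (Module.End.mem_maxGenEigenspace _ _ _).1 hx
      have hinj : Function.Injective (f - μ • (1 : Module.End ℂ (Fin (p 0 + r 0) → ℂ))) := by
        rw [← LinearMap.ker_eq_bot, LinearMap.ker_eq_bot']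
        intro y hy
        refine companion_eigenvector_eq_zero hP hc h ?_
        rw [LinearMap.sub_apply, sub_eq_zero] at hy
        exact hy
      have hx0 : x = 0 := by
        have h1 : Function.Injective
            ((f - μ • (1 : Module.End ℂ (Fin (p 0 + r 0) → ℂ))) ^ k) := by
          rw [Module.End.coe_pow]
          exact hinj.iterate k
        exact h1 (by rw [hk, map_zero])
      rw [hx0]
      exact Submodule.zero_mem _
    · exact le_sup_of_le_right
        (le_iSup (fun μ : {μ : ℂ // 1 < ‖μ‖} => Module.End.maxGenEigenspace f μ) ⟨μ, h⟩)

end Companion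

end

theorem theorem1 (m s : ℕ) (r p : Fin (m + 1) → ℕ)
    (Δ : Set (ℝ × (Fin (m + 1) → ℝ)))
    (hΔ : ∀ τ ∈ Δ, 0 < τ.1 ∧ ∀ k, 0 < τ.2 k)
    (a : ℝ × (Fin (m + 1) → ℝ) → Coefs m s)
    (hsolv : ∀ τ ∈ Δ, Solvable r p (a τ))
    (hstab : ∀ τ ∈ Δ, StableScheme r p (a τ))
    (hnonchar : ∀ τ ∈ Δ, WeakNonchar r p (a τ))
    (htech : ∀ τ ∈ Δ, TechnicalCondition r p (a τ)) :
    ∀ τ ∈ Δ, ∃ Pi : ℕ → (TangSpace m (p 0 + r 0) →L[ℂ] TangSpace m (p 0 + r 0)),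
      -- the operators are the Fourier multipliers whose symbols are the Laurent coefficients
      -- at infinity of the stable spectral projector of the companion matrix
      (∃ S : ℕ → (Fin m → ℝ) → Matrix (Fin (p 0 + r 0)) (Fin (p 0 + r 0)) ℂ,
        (∀ n, Continuous (S n)) ∧
        (∀ n, IsFourierMultiplier (S n) (Pi n)) ∧
        ∀ (z : ℂ) (η : Fin m → ℝ), 1 < ‖z‖ →
          ∃ P : Matrix (Fin (p 0 + r 0)) (Fin (p 0 + r 0)) ℂ,
            IsStableProjector (companion r p (a τ) z η) P ∧
            HasSum (fun n : ℕ => (z ^ n)⁻¹ • S n η) P) ∧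
      -- growth condition
      (∀ δ : ℝ, 0 < δ → Summable fun n : ℕ => ‖Pi n‖ / (1 + δ) ^ n) ∧
      -- algebraic constraints
      (∀ n : ℕ, Pi n = ∑ k ∈ Finset.range (n + 1), (Pi k).comp (Pi (n - k))) ∧
      -- relations satisfied by the solution of the Cauchy problem
      (∀ (f : Fin (s + 1) → SeqSpace m) (u : ℕ → SeqSpace m),
        (∀ (σ : Fin (s + 1)) (j : Idx m), j 0 ≤ (p 0 : ℤ) → f σ j = 0) →
        IsCauchySolution r p (a τ) f u →
        ∀ (n : ℕ) (j₁ : ℤ), j₁ ≤ 0 →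
          ∑ k ∈ Finset.range (n + 1),
            Pi (n - k) (window (p 0 + r 0) (u k) (j₁ + (p 0 : ℤ))) = 0) ∧
      -- the leading operator for explicit schemes
      (IsExplicit r p (a τ) →
        ∀ (v : TangSpace m (p 0 + r 0)) (j : Fin m → ℤ) (i : Fin (p 0 + r 0)),
          Pi 0 v j i = if (i : ℕ) < p 0 then 0 else v j i) := by
  intro τ hτ
  have h := hsolv τ hτ
  have hs := hstab τ hτ
  refine ⟨h.proj, ⟨projSymbol r p (a τ), h.continuous_projSymbol, h.isFourierMultiplier,
    fun z η hz => ⟨resolventProj r p (a τ) z η, ?_, h.hasSum_projSymbol hs hz η⟩⟩,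
    fun δ hδ => h.summable_norm_proj hs hδ, h.proj_eq_sum,
    fun f u hf hu n j₁ hj₁ => h.proj_window_eq_zero hf hu n j₁ hj₁,
    fun he v j i => h.proj_zero_of_isExplicit he v j i⟩
  rw [resolventProj_eq]
  refine isStableProjector_scalarProj (hnonchar τ hτ z η hz).2 fun ξ => ?_
  -- The scalar symbol at `ξ` is the symbol of `L(z)` at the frequency `(ξ, η)`.
  rw [← convSymbol_resolventCoef_eq]
  exact h.convSymbol_resolventCoef_ne_zero hs hz _
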